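/- **Setting.** For each $n\ge 0$ let $\mathcal A_n$ be a finite nonempty alphabet, and let $\boldsymbol\tau=(\tau_n:\mathcal A_{n+1}^*\to\mathcal A_n^*)_{n\ge 0}$ be a sequence of nonerasing morphisms of free monoids (a directive sequence). Write $|w|$ for the length of a word $w$, $|w|_a$ for the number of occurrences of the letter $a$ in $w$, and $|v|$ for the sum of the entries of a nonnegative vector $v$. For $n\le N$ put $\tau_{[n,N)}=\tau_n\circ\tau_{n+1}\circ\dots\circ\tau_{N-1}$ (the identity if $n=N$). Let $X^{(n)}_{\boldsymbol\tau}$ be the set of all $x\in\mathcal A_n^{\mathbb Z}$ such that every finite word occurring in $x$ occurs in $\tau_{[n,N)}(a)$ for some $N>n$ and $a\in\mathcal A_N$; put $X_{\boldsymbol\tau}=X^{(0)}_{\boldsymbol\tau}$, and let $S$ be the shift map. A nonerasing morphism is extended to two-sided sequences by concatenation: $\tau(x)=\cdots\tau(x_{-1}).\tau(x_0)\tau(x_1)\cdots$, where $\tau(x_0)$ starts at coordinate $0$. The sequence $\boldsymbol\tau$ is of *constant length* if for every $n\ge 1$ the length of $\tau_n(a)$ does not depend on $a\in\mathcal A_{n+1}$.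 It is *recognizable* if for every $n\ge 0$ the sets $$S^k\tau_{[0,n)}([a]),\qquad a\in\mathcal A_n,\ 0\le k<|\tau_{[0,n)}(a)|,\qquad [a]=\{y\in X^{(n)}_{\boldsymbol\tau}: y_0=a\},$$ are pairwise disjoint for distinct indices $(a,k)$ and have union $X_{\boldsymbol\tau}$ (some of them may be empty). A *contraction* of $\boldsymbol\tau$ is a sequence $\boldsymbol\tau'=(\tau'_k=\tau_{[n_k,n_{k+1})})_{k\ge 0}$ with $0=n_0<n_1<n_2<\cdots$. The system $(X_{\boldsymbol\tau},S)$ is *uniquely ergodic* if it has exactly one $S$-invariant Borel probability measure. **Theorem.** Let $\boldsymbol\tau$ be a constant length and recognizable directive sequence with $X_{\boldsymbol\tau}\neq\emptyset$. The following are equivalent. 1. There is a contraction $\boldsymbol\tau'=(\tau'_k=\tau_{[n_k,n_{k+1})})_{k\ge 0}$ of $\boldsymbol\tau$ such that the vectors $v_k$ given by $$v_k(a)=\min_{b\in\mathcal A_{n_{k+1}}}|\tau'_k(b)|_a,\qquad a\in\mathcal A_{n_k},\ k\ge 0,$$ satisfy $$\sum_{k\ge 0}\frac{|v_k|}{|\tau'_k|}=+\infty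 .$$ 2. The system $(X_{\boldsymbol\tau},S)$ is uniquely ergodic. Here $|\tau'_k|$ is the common length of the words $\tau'_k(b)$, $b\in\mathcal A_{n_{k+1}}$. (Only for $k=0$ can these lengths differ, namely when $\tau_0$ is not of constant length; $|\tau'_0|$ then denotes the largest of them. This concerns a single finite term and does not affect the divergence.) -/

import Mathlib

open MeasureTheory Filter

/-! ### Dynamical systems -/

/-- A topological system is uniquely ergodic if it has exactly one invariant Borel probability
measure. -/
def IsUniquelyErgodic {X : Type*} [TopologicalSpace X] [MeasurableSpace X] [BorelSpace X]
    (T : X → X) : Prop :=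
  ∃! μ : Measure X, IsProbabilityMeasure μ ∧ MeasurePreserving T μ μ

/-- The shift map on two-sided sequences. -/
def shift {A : Type*} (x : ℤ → A) : ℤ → A := fun i => x (i + 1)

/-- The word `x_m x_{m+1} ... x_{m+l-1}` read in the two-sided sequence `x`. -/
def window {A : Type*} (x : ℤ → A) (m : ℤ) (l : ℕ) : FreeMonoid A :=
  FreeMonoid.ofList ((List.range l).map fun j => x (m + j))

/-! ### Morphisms between free monoids -/

section Morphism

/-- The word `σ(a)`, as a list of letters. -/
def letterImage {A B : Type*} (σ : FreeMonoid A →* FreeMonoid B) (a : A) : List B :=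
  FreeMonoid.toList (σ (FreeMonoid.of a))

def IsNonerasing {A B : Type*} (σ : FreeMonoid A →* FreeMonoid B) : Prop :=
  ∀ a, letterImage σ a ≠ []

def IsConstantLength {A B : Type*} (σ : FreeMonoid A →* FreeMonoid B) : Prop :=
  ∀ a b, (letterImage σ a).length = (letterImage σ b).length

/-- The length `|σ|` of a morphism: the common length of the words `σ(a)` when `σ` is of constant
length (in general, the largest of these lengths). -/
def morphismLength {A B : Type*} [Fintype A] (σ : FreeMonoid A →* FreeMonoid B) : ℕ :=
  Finset.univ.sup fun a => (letterImage σ a).length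

/-- The composition matrix: its entry at `(b, a)` is the number of occurrences of `b` in `σ(a)`. -/
def compositionMatrix {A B : Type*} [DecidableEq B] (σ : FreeMonoid A →* FreeMonoid B) :
    Matrix B A ℕ :=
  Matrix.of fun b a => (letterImage σ a).count b

/-- The vector whose entry at `b` is the least number of occurrences of `b` in a word `σ(a)`. -/
def minVector {A B : Type*} [Fintype A] [Nonempty A] [DecidableEq B]
    (σ : FreeMonoid A →* FreeMonoid B) (b : B) : ℕ :=
  Finset.univ.inf' Finset.univ_nonempty fun a => compositionMatrix σ b a

/-- `IsImage σ x y` says that the two-sided sequence `y` is `σ(x)`, the concatenation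
`... σ(x_{-2}) σ(x_{-1}) . σ(x_0) σ(x_1) ...`: the word `σ(x_i)` occupies the
coordinates from `p i` to `p (i + 1) - 1`, and `p 0 = 0`. -/
def IsImage {A B : Type*} (σ : FreeMonoid A →* FreeMonoid B) (x : ℤ → A) (y : ℤ → B) : Prop :=
  ∃ p : ℤ → ℤ, p 0 = 0 ∧
    (∀ i, p (i + 1) = p i + ((letterImage σ (x i)).length : ℤ)) ∧
    ∀ (i : ℤ) (j : ℕ) (hj : j < (letterImage σ (x i)).length),
      y (p i + j) = (letterImage σ (x i))[j]

/-- A nonerasing morphism defines a map on two-sided sequences. -/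
theorem IsImage.existsUnique {A B : Type*} (σ : FreeMonoid A →* FreeMonoid B)
    (hσ : IsNonerasing σ) (x : ℤ → A) : ∃! y : ℤ → B, IsImage σ x y := by
  have hpos : ∀ i, (0 : ℤ) < ((letterImage σ (x i)).length : ℤ) := fun i => by
    exact_mod_cast List.length_pos_iff.mpr (hσ (x i))
  have cover : ∀ p : ℤ → ℤ, p 0 = 0 →
      (∀ i, p (i + 1) = p i + ((letterImage σ (x i)).length : ℤ)) →
      StrictMono p ∧ ∀ t, ∃ i, p i ≤ t ∧ t < p (i + 1) := by
    intro p h0 hp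
    have hm : StrictMono p := strictMono_int_of_lt_succ fun i => by
      have := hpos i; have := hp i; omega
    refine ⟨hm, fun t => ?_⟩
    have hup : ∀ n : ℕ, (n : ℤ) ≤ p n := by
      intro n
      induction n with
      | zero => simp [h0]
      | succ n ih => have := hm (show (n : ℤ) < n + 1 by omega); push_cast; omega
    have hdn : ∀ n : ℕ, p (-(n : ℤ)) ≤ -n := by
      intro n
      induction n with
      | zero => simp [h0]
      | succ n ih => have := hm (show (-(n : ℤ) - 1) < -n by omega)
                     rw [show (-((n + 1 : ℕ) : ℤ)) = -(n : ℤ) - 1 by push_cast; ring]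
                     push_cast; omega
    obtain ⟨i, hi, hmax⟩ := Int.exists_greatest_of_bdd (P := fun i => p i ≤ t)
      ⟨t.toNat + 1, fun z hz => by
        by_contra hlt
        have h1 := hm.monotone (show ((t.toNat + 1 : ℕ) : ℤ) ≤ z by push_cast; omega)
        have h2 := hup (t.toNat + 1)
        omega⟩
      ⟨-(((-t).toNat : ℕ) : ℤ), by have := hdn (-t).toNat; omega⟩
    exact ⟨i, hi, by by_contra h; have := hmax (i + 1) (by omega); omega⟩
  obtain ⟨p, h0, hp⟩ : ∃ p : ℤ → ℤ, p 0 = 0 ∧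
      ∀ i, p (i + 1) = p i + ((letterImage σ (x i)).length : ℤ) := by
    let L : ℤ → ℤ := fun i => ((letterImage σ (x i)).length : ℤ)
    refine ⟨fun i => (∑ j ∈ Finset.range i.toNat, L j)
      - ∑ j ∈ Finset.range (-i).toNat, L (-(j : ℤ) - 1), by simp, fun i => ?_⟩
    rcases lt_or_ge i 0 with h | h
    · obtain ⟨n, rfl⟩ : ∃ n : ℕ, i = -(n : ℤ) - 1 := ⟨(-i - 1).toNat, by omega⟩
      have e1 : (-(-(n : ℤ) - 1 + 1)).toNat = n := by omega
      have e2 : (-(-(n : ℤ) - 1)).toNat = n + 1 := by omega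
      have e3 : (-(n : ℤ) - 1 + 1).toNat = 0 := by omega
      have e4 : (-(n : ℤ) - 1).toNat = 0 := by omega
      simp only [e1, e2, e3, e4, Finset.sum_range_succ, Finset.sum_range_zero, L]
      ring
    · obtain ⟨n, rfl⟩ : ∃ n : ℕ, i = n := ⟨i.toNat, by omega⟩
      have e1 : (-((n : ℤ) + 1)).toNat = 0 := by omega
      have e2 : (-(n : ℤ)).toNat = 0 := by omega
      have e3 : ((n : ℤ) + 1).toNat = n + 1 := by omega
      have e4 : (n : ℤ).toNat = n := by omega
      simp only [e1, e2, e3, e4, Finset.sum_range_succ, Finset.sum_range_zero, L]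
      ring
  obtain ⟨hm, hc⟩ := cover p h0 hp
  choose c hc1 hc2 using hc
  have hcu : ∀ i (j : ℕ), j < (letterImage σ (x i)).length → c (p i + j) = i := by
    intro i j hj
    have h1 := hc1 (p i + j)
    have h2 := hc2 (p i + j)
    have h3 := hp i
    have h4 : c (p i + j) < i + 1 := hm.lt_iff_lt.mp (by omega)
    have h5 : i < c (p i + j) + 1 := hm.lt_iff_lt.mp (by omega)
    omega
  have hin : ∀ t, (t - p (c t)).toNat < (letterImage σ (x (c t))).length := fun t => by
    have := hp (c t); have := hc1 t; have := hc2 t; omega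
  refine ⟨fun t => (letterImage σ (x (c t)))[(t - p (c t)).toNat]'(hin t),
    ⟨p, h0, hp, fun i j hj => ?_⟩, ?_⟩
  · have h := hcu i j hj
    have key : ∀ k, k = i → ∀ hk, (letterImage σ (x k))[(p i + j - p k).toNat]'hk
        = (letterImage σ (x i))[j] := by
      rintro k rfl hk
      congr 1
      omega
    exact key _ h _
  · rintro y ⟨q, q0, hq, hy⟩
    have hqp : q = p := by
      funext i
      induction i using Int.induction_on with
      | zero => rw [q0, h0]
      | succ n ih => rw [hq, hp, ih]
      | pred n ih =>
        have h1 := hq (-(n : ℤ) - 1)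
        have h2 := hp (-(n : ℤ) - 1)
        rw [sub_add_cancel] at h1 h2
        omega
    subst hqp
    funext t
    have := hy (c t) (t - q (c t)).toNat (hin t)
    rw [← this]
    congr 1
    have := hc1 t
    omega

end Morphism

/-! ### Directive sequences -/

/-- A sequence of morphisms `τ_n : A_{n+1}^* → A_n^*`, `n ≥ 0`. -/
abbrev DirectiveSequence (A : ℕ → Type*) : Type _ :=
  ∀ n : ℕ, FreeMonoid (A (n + 1)) →* FreeMonoid (A n)

namespace DirectiveSequence

/-- All morphisms are nonerasing. -/
def Nonerasing {A : ℕ → Type*} (τ : DirectiveSequence A) : Prop :=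
  ∀ n, IsNonerasing (τ n)

/-- All morphisms `τ_n` with `n ≥ 1` are of constant length. -/
def ConstantLength {A : ℕ → Type*} (τ : DirectiveSequence A) : Prop :=
  ∀ n, 1 ≤ n → IsConstantLength (τ n)

/-- The morphism `τ_{[n,N)} = τ_n ∘ τ_{n+1} ∘ ... ∘ τ_{N-1}` (the identity if `n = N`). -/
def block {A : ℕ → Type*} (τ : DirectiveSequence A) {n N : ℕ} (h : n ≤ N) :
    FreeMonoid (A N) →* FreeMonoid (A n) :=
  Nat.leRec (motive := fun m _ => FreeMonoid (A m) →* FreeMonoid (A n))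
    (MonoidHom.id _) (fun m _ σ => σ.comp (τ m)) h

theorem block_self {A : ℕ → Type*} (τ : DirectiveSequence A) (n : ℕ) :
    τ.block (le_refl n) = MonoidHom.id _ := by
  simp [block]

theorem block_succ {A : ℕ → Type*} (τ : DirectiveSequence A) {n N : ℕ} (h : n ≤ N) :
    τ.block (Nat.le_succ_of_le h) = (τ.block h).comp (τ N) := by
  simp only [block]
  rw [Nat.leRec_succ]

/-- The contraction `(τ_{[n_k, n_{k+1})})_k` of `τ` along a strictly increasing sequence `n`. -/
def contraction {A : ℕ → Type*} (τ : DirectiveSequence A) (n : ℕ → ℕ) (hn : StrictMono n) :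
    DirectiveSequence fun k => A (n k) :=
  fun k => τ.block (hn.monotone (Nat.le_succ k))

/-- The language of level `n`: the words that occur in `τ_{[n,N)}(a)` for some `N > n` and some
letter `a` of `A_N`. -/
def language {A : ℕ → Type*} (τ : DirectiveSequence A) (n : ℕ) : Set (FreeMonoid (A n)) :=
  {w | ∃ (N : ℕ) (h : n < N) (a : A N), FreeMonoid.toList w <:+: letterImage (τ.block h.le) a}

/-- The set `X^{(n)}` of two-sided sequences all of whose words belong to the language of
level `n`. -/
def levelShift {A : ℕ → Type*} (τ : DirectiveSequence A) (n : ℕ) : Set (ℤ → A n) :=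
  {x | ∀ (m : ℤ) (l : ℕ), window x m l ∈ τ.language n}

theorem mapsTo_shift {A : ℕ → Type*} (τ : DirectiveSequence A) (n : ℕ) :
    Set.MapsTo shift (τ.levelShift n) (τ.levelShift n) := by
  intro x hx m l
  have h : window (shift x) m l = window x (m + 1) l := by
    simp only [window, shift]
    congr 2
    funext j
    congr 1
    ring
  rw [h]
  exact hx _ _

/-- The phase space `X` of the S-adic subshift generated by `τ`. -/
def subshift {A : ℕ → Type*} (τ : DirectiveSequence A) : Set (ℤ → A 0) := τ.levelShift 0

/-- The shift map of the S-adic subshift generated by `τ`. -/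
def subshiftMap {A : ℕ → Type*} (τ : DirectiveSequence A) : τ.subshift → τ.subshift :=
  (τ.mapsTo_shift 0).restrict shift (τ.levelShift 0) (τ.levelShift 0)

/-- The set `τ_{[0,n)}([a])`, where `[a]` is the set of all `y` in `X^{(n)}` with `y_0 = a`. -/
def base {A : ℕ → Type*} (τ : DirectiveSequence A) (n : ℕ) (a : A n) : Set (ℤ → A 0) :=
  {x | ∃ y ∈ τ.levelShift n, y 0 = a ∧ IsImage (τ.block (Nat.zero_le n)) y x}

/-- The height `|τ_{[0,n)}(a)|`. -/
def height {A : ℕ → Type*} (τ : DirectiveSequence A) (n : ℕ) (a : A n) : ℕ :=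
  (letterImage (τ.block (Nat.zero_le n)) a).length

/-- The sequence `τ` is recognizable: for every `n`, the sets `S^k τ_{[0,n)}([a])`, indexed by the
letters `a` of `A_n` and the integers `0 ≤ k < |τ_{[0,n)}(a)|`, form a partition of the subshift
generated by `τ`. (The set with index `(a, k)` is empty if `a` does not occur in `X^{(n)}`.) -/
def Recognizable {A : ℕ → Type*} (τ : DirectiveSequence A) : Prop :=
  ∀ n : ℕ,
    (⋃ i : Σ a : A n, Fin (τ.height n a), shift^[i.2] '' τ.base n i.1) = τ.subshift ∧
    Pairwise fun i j : Σ a : A n, Fin (τ.height n a) =>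
      Disjoint (shift^[i.2] '' τ.base n i.1) (shift^[j.2] '' τ.base n j.1)

end DirectiveSequence

/-! Divide the entries of the composition matrix of a constant length morphism by its length: every
column becomes a probability vector, and `dobrushin` is the total mass common to all columns.
Replacing a function on letters by its means over the images of letters shrinks its oscillation by
the factor `1 - dobrushin` (`abs_letterMean_sub_le`), and constant length makes such means compose
(`letterMean_comp`).

Divergence implies uniqueness. Since `1 - δ ≤ exp (-δ)`, a divergent sum makes the oscillation of
any function of level `n k`, with `k ≥ 1`, tend to zero. For the number of occurrences of `w` and
for the height this gives nearly equal frequencies of `w` in all words `τ_{[0,N)}(b)`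
(`exists_uniform_frequency`). By recognizability the towers of level `N` partition the subshift, so
an invariant measure gives the cylinder of `w` an average of these frequencies, up to occurrences
straddling two towers. Two invariant measures therefore agree on cylinders. Existence comes from
weak limits of orbit measures.

Uniqueness implies divergence. Suppose that for some `n ≥ 1` every block from level `n` has
coefficient below `1/2`. Then at each level `N > n` two letters have images in which some letter
frequency differs by more than `1 / (2 |A_n|)` (`half_le_dobrushin`). Limits along one ultrafilter
give two invariant measures on the shift of level `n` with different letter measures. Both lift to
the subshift through the towers (`exists_lift`), and uniqueness there forces equal letter measures
(`measure_letter_eq`), a contradiction. So from every level `n ≥ 1` some block has coefficient at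
least `1/2`, and chaining such blocks gives the contraction. -/

section Words

/-! ### Words, letter counts and occurrences of a word. -/

theorem toList_map_eq_flatMap {A B : Type*} (σ : FreeMonoid A →* FreeMonoid B) (w : FreeMonoid A) :
    FreeMonoid.toList (σ w) = (FreeMonoid.toList w).flatMap (letterImage σ) := by
  induction w using FreeMonoid.inductionOn' with
  | one => simp
  | of_mul a w ih => simp [ih, letterImage]

theorem letterImage_comp {A B C : Type*} (σ : FreeMonoid B →* FreeMonoid C)
    (ρ : FreeMonoid A →* FreeMonoid B) (a : A) :
    letterImage (σ.comp ρ) a = (letterImage ρ a).flatMap (letterImage σ) := by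
  rw [letterImage, MonoidHom.comp_apply, toList_map_eq_flatMap]; rfl

theorem letterImage_id {A : Type*} (a : A) : letterImage (MonoidHom.id (FreeMonoid A)) a = [a] := by
  simp [letterImage]

theorem IsNonerasing.length_pos {A B : Type*} {σ : FreeMonoid A →* FreeMonoid B}
    (h : IsNonerasing σ) (a : A) : 0 < (letterImage σ a).length :=
  List.length_pos_iff.mpr (h a)

theorem List.sum_map_eq_sum_count {A : Type*} [Fintype A] [DecidableEq A] (u : List A)
    (g : A → ℝ) : (u.map g).sum = ∑ a, (u.count a : ℝ) * g a := by
  induction u with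
  | nil => simp
  | cons x u ih =>
    simp only [List.map_cons, List.sum_cons, ih, List.count_cons, Nat.cast_add, add_mul,
      Finset.sum_add_distrib, beq_iff_eq]
    simp [add_comm]

theorem List.sum_count_eq_length {A : Type*} [Fintype A] [DecidableEq A] (u : List A) :
    ∑ a, (u.count a : ℝ) = u.length := by
  simpa using (u.sum_map_eq_sum_count (fun _ => (1 : ℝ))).symm

theorem List.sum_map_flatMap {A B : Type*} (u : List A) (f : A → List B) (g : B → ℝ) :
    ((u.flatMap f).map g).sum = (u.map fun a => ((f a).map g).sum).sum := by
  induction u with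
  | nil => simp
  | cons x u ih => simp [ih]

theorem List.length_flatMap_cast {A B : Type*} (u : List A) (f : A → List B) :
    ((u.flatMap f).length : ℝ) = (u.map fun a => ((f a).length : ℝ)).sum := by
  induction u with
  | nil => simp
  | cons x u ih =>
    rw [List.flatMap_cons, List.length_append, Nat.cast_add, ih, List.map_cons, List.sum_cons]

/-- The number of occurrences of the word `w` in the word `u`. -/
def occurrences {A : Type*} [DecidableEq A] (w u : List A) : ℕ :=
  ∑ k ∈ Finset.range u.length, if w <+: u.drop k then 1 else 0

variable {A : Type*} [DecidableEq A]

theorem occurrences_nil (w : List A) : occurrences w [] = 0 := by simp [occurrences]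

theorem occurrences_cons (w u : List A) (x : A) :
    occurrences w (x :: u) = occurrences w u + if w <+: x :: u then 1 else 0 := by
  rw [occurrences, List.length_cons, Finset.sum_range_succ']; rfl

theorem occurrences_le_length (w u : List A) : occurrences w u ≤ u.length := by
  unfold occurrences
  refine (Finset.sum_le_sum (g := fun _ => 1) fun k _ => ?_).trans (by simp)
  split_ifs <;> simp

theorem occurrences_add_le (w u v : List A) :
    occurrences w u + occurrences w v ≤ occurrences w (u ++ v) := by
  induction u with
  | nil => simp [occurrences_nil]
  | cons x u ih =>
    rw [List.cons_append, occurrences_cons, occurrences_cons]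
    have : w <+: x :: u → w <+: x :: (u ++ v) := fun h =>
      h.trans (by rw [← List.cons_append]; exact List.prefix_append _ _)
    split_ifs <;> first | omega | tauto

/-- An occurrence in neither factor starts in `u` and ends in `v`. In the induction, prepending a
letter to `u` can create one only while `u` is shorter than `w`, hence the minimum. -/
theorem occurrences_append_le (w u v : List A) :
    occurrences w (u ++ v) ≤ occurrences w u + occurrences w v + min u.length w.length := by
  induction u with
  | nil => simp [occurrences_nil]
  | cons x u ih =>
    rw [List.cons_append, occurrences_cons, occurrences_cons]
    by_cases hl : w.length ≤ (x :: u).length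
    · have : w <+: x :: (u ++ v) → w <+: x :: u := fun h => by
        rw [← List.cons_append] at h
        exact List.prefix_of_prefix_length_le h (List.prefix_append _ _) hl
      simp only [List.length_cons] at hl ⊢
      split_ifs <;> first | omega | tauto
    · simp only [List.length_cons, not_le] at hl ⊢
      split_ifs <;> omega

theorem occurrences_eq_zero_of_not_infix {w u : List A} (h : ¬ w <:+: u) :
    occurrences w u = 0 := by
  refine Finset.sum_eq_zero fun k _ => ?_
  rw [if_neg]
  exact fun hk => h (hk.isInfix.trans (List.drop_suffix k u).isInfix)

theorem occurrences_singleton (a : A) (u : List A) : occurrences [a] u = u.count a := by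
  induction u with
  | nil => simp [occurrences_nil]
  | cons x u ih =>
    rw [occurrences_cons, ih, List.count_cons]
    congr 1
    simp only [List.cons_prefix_cons, List.nil_prefix, and_true, beq_iff_eq]
    exact if_congr eq_comm rfl rfl

theorem sum_occurrences_le_flatMap {B : Type*} (w : List A) (u : List B) (f : B → List A) :
    (u.map fun b => (occurrences w (f b) : ℝ)).sum ≤ occurrences w (u.flatMap f) := by
  induction u with
  | nil => simp
  | cons x u ih =>
    have := occurrences_add_le w (f x) (u.flatMap f)
    have : (occurrences w (f x) : ℝ) + occurrences w (u.flatMap f)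
      ≤ occurrences w (f x ++ u.flatMap f) := by exact_mod_cast this
    simp only [List.map_cons, List.sum_cons, List.flatMap_cons]
    linarith

theorem occurrences_flatMap_le {B : Type*} (w : List A) (u : List B) (f : B → List A) :
    (occurrences w (u.flatMap f) : ℝ) ≤
      (u.map fun b => (occurrences w (f b) : ℝ)).sum + u.length * w.length := by
  induction u with
  | nil => simp [occurrences_nil]
  | cons x u ih =>
    have := occurrences_append_le w (f x) (u.flatMap f)
    have h2 := min_le_right (f x).length w.length
    have : (occurrences w (f x ++ u.flatMap f) : ℝ) ≤
        (occurrences w (f x) : ℝ) + occurrences w (u.flatMap f) + w.length := by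
      exact_mod_cast this.trans (by omega)
    simp only [List.map_cons, List.sum_cons, List.flatMap_cons, List.length_cons, Nat.cast_add,
      Nat.cast_one]
    linarith

end Words

/-! ### Averaging over images of letters, and its contraction coefficient. -/

section LetterMean

variable {A B C : Type*}

/-- The mean value of `g` over the letters of the word `σ(a)`. -/
noncomputable def letterMean (σ : FreeMonoid A →* FreeMonoid B) (g : B → ℝ) (a : A) : ℝ :=
  ((letterImage σ a).map g).sum / (letterImage σ a).length

/-- Constant length of the outer morphism `σ` gives all letters of `ρ(a)` equal weight, so that a
mean of means is the overall mean. -/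
theorem letterMean_comp (σ : FreeMonoid B →* FreeMonoid C) (ρ : FreeMonoid A →* FreeMonoid B)
    (hσ : IsNonerasing σ) (hσ' : IsConstantLength σ) (g : C → ℝ) :
    letterMean (σ.comp ρ) g = letterMean ρ (letterMean σ g) := by
  funext a
  unfold letterMean
  rw [letterImage_comp, List.sum_map_flatMap, List.length_flatMap_cast]
  -- An empty `ρ(a)` makes both sides `0 / 0 = 0`.
  rcases h : letterImage ρ a with _ | ⟨b, u⟩
  · simp
  have hb : ((letterImage σ b).length : ℝ) ≠ 0 := by
    exact_mod_cast (hσ.length_pos b).ne'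
  have e : ∀ c, ((letterImage σ c).length : ℝ) = (letterImage σ b).length := fun c => by
    rw [hσ' c b]
  simp only [e, List.map_const', List.sum_replicate, nsmul_eq_mul, div_eq_mul_inv]
  rw [List.sum_map_mul_right]
  have : ((b :: u).length : ℝ) ≠ 0 := by simp; positivity
  field_simp

theorem IsConstantLength.morphismLength_eq [Fintype A] {σ : FreeMonoid A →* FreeMonoid B}
    (hσ : IsConstantLength σ) (a : A) : morphismLength σ = (letterImage σ a).length := by
  unfold morphismLength
  apply le_antisymm
  · exact Finset.sup_le fun b _ => (hσ b a).le
  · exact Finset.le_sup (f := fun a => (letterImage σ a).length) (Finset.mem_univ a)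

theorem minVector_le [Fintype A] [Nonempty A] [DecidableEq B] (σ : FreeMonoid A →* FreeMonoid B)
    (b : B) (a : A) : minVector σ b ≤ (letterImage σ a).count b :=
  Finset.inf'_le (f := fun a => compositionMatrix σ b a) (Finset.mem_univ a)

/-- The sum of the entries of the vector of minimal numbers of occurrences, divided by the length
of the morphism. -/
noncomputable def dobrushin [Fintype A] [Nonempty A] [Fintype B] [DecidableEq B]
    (σ : FreeMonoid A →* FreeMonoid B) : ℝ :=
  (∑ b, (minVector σ b : ℝ)) / (morphismLength σ : ℝ)

/-- Remove from both words the common part, `minVector σ b` copies of each letter `b`; it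
contributes equally to both sums. On the remaining letters `g` lies between its minimum and its
minimum plus `D`, and they form the proportion `1 - dobrushin σ` of each word. -/
theorem abs_letterMean_sub_le [Fintype A] [Nonempty A] [Fintype B] [DecidableEq B]
    (σ : FreeMonoid A →* FreeMonoid B) (hσ : IsNonerasing σ) (hσ' : IsConstantLength σ)
    (g : B → ℝ) {D : ℝ} (hg : ∀ b b', |g b - g b'| ≤ D) (a a' : A) :
    |letterMean σ g a - letterMean σ g a'| ≤ (1 - dobrushin σ) * D := by
  wlog hle : letterMean σ g a' ≤ letterMean σ g a generalizing a a'
  · rw [abs_sub_comm]; exact this a' a (le_of_not_ge hle)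
  rw [abs_of_nonneg (sub_nonneg.mpr hle)]
  have : Nonempty B := ⟨(letterImage σ a).head (hσ a)⟩
  obtain ⟨b₀, hb₀⟩ := Finite.exists_min g
  have hgD : ∀ b, g b ≤ g b₀ + D := fun b => by
    have := hg b b₀; have := le_abs_self (g b - g b₀); linarith
  have hL : (0 : ℝ) < (letterImage σ a).length := by exact_mod_cast hσ.length_pos a
  unfold letterMean dobrushin
  rw [hσ'.morphismLength_eq a, hσ' a' a, List.sum_map_eq_sum_count, List.sum_map_eq_sum_count]
  have h1 : ∑ b, ((letterImage σ a).count b - minVector σ b : ℝ) * g b ≤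
      ∑ b, ((letterImage σ a).count b - minVector σ b : ℝ) * (g b₀ + D) :=
    Finset.sum_le_sum fun b _ => mul_le_mul_of_nonneg_left (hgD b)
      (sub_nonneg.mpr (by exact_mod_cast minVector_le σ b a))
  have h2 : ∑ b, ((letterImage σ a').count b - minVector σ b : ℝ) * g b₀ ≤
      ∑ b, ((letterImage σ a').count b - minVector σ b : ℝ) * g b :=
    Finset.sum_le_sum fun b _ => mul_le_mul_of_nonneg_left (hb₀ b)
      (sub_nonneg.mpr (by exact_mod_cast minVector_le σ b a'))
  rw [← Finset.sum_mul, Finset.sum_sub_distrib, List.sum_count_eq_length] at h1 h2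
  simp only [sub_mul, Finset.sum_sub_distrib] at h1 h2
  rw [hσ' a' a] at h2
  rw [← sub_div, one_sub_div hL.ne', div_mul_eq_mul_div]
  refine div_le_div_of_nonneg_right ?_ hL.le
  linarith

theorem dobrushin_nonneg [Fintype A] [Nonempty A] [Fintype B] [DecidableEq B]
    (σ : FreeMonoid A →* FreeMonoid B) : 0 ≤ dobrushin σ := by
  unfold dobrushin; positivity

end LetterMean

/-! ### Composition of blocks of a directive sequence. -/

namespace DirectiveSequence

variable {A : ℕ → Type*} (τ : DirectiveSequence A)

theorem block_trans {n m N : ℕ} (h : n ≤ m) (h' : m ≤ N) :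
    τ.block (h.trans h') = (τ.block h).comp (τ.block h') := by
  induction N, h' using Nat.le_induction with
  | base => rw [block_self]; rfl
  | succ N hN ih => rw [block_succ τ (h.trans hN), block_succ τ hN, ih]; rfl

theorem letterImage_block_trans {n m N : ℕ} (h : n ≤ m) (h' : m ≤ N) (a : A N) :
    letterImage (τ.block (h.trans h')) a =
      (letterImage (τ.block h') a).flatMap (letterImage (τ.block h)) := by
  rw [block_trans, letterImage_comp]

variable {τ}

theorem Nonerasing.block (hτ : τ.Nonerasing) {n N : ℕ} (h : n ≤ N) : IsNonerasing (τ.block h) := by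
  induction N, h using Nat.le_induction with
  | base => rw [block_self]; intro a; simp [letterImage_id]
  | succ N hN ih =>
    rw [block_succ τ hN]
    intro a
    rw [letterImage_comp]
    obtain ⟨b, hb⟩ := List.exists_mem_of_ne_nil _ (hτ N a)
    simp only [ne_eq, List.flatMap_eq_nil_iff, not_forall]
    exact ⟨b, hb, ih b⟩

theorem ConstantLength.block (hτ : τ.ConstantLength) {n N : ℕ} (h : n ≤ N) (hn : 1 ≤ n) :
    IsConstantLength (τ.block h) := by
  induction N, h using Nat.le_induction with
  | base => rw [block_self]; intro a b; simp [letterImage_id]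
  | succ N hN ih =>
    rw [block_succ τ hN]
    intro a b
    rw [letterImage_comp, letterImage_comp, List.length_flatMap, List.length_flatMap]
    have e : ∀ d, (fun c => (letterImage (τ.block hN) c).length) =
        fun _ => (letterImage (τ.block hN) d).length := fun d => by
      funext c; exact ih c d
    have hl := hτ N (hn.trans hN) a b
    rcases ha : letterImage (τ N) a with _ | ⟨d, u⟩
    · rw [ha] at hl
      rw [List.length_eq_zero_iff.mp hl.symm]
    · rw [ha] at hl
      simp only [e d, List.map_const', List.sum_replicate, hl]

end DirectiveSequence

/-! ### Cylinders, orbit measures and their invariant limits. -/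

section SequenceSpace

open Topology

variable {B : Type*}

theorem shift_iterate_apply (k : ℕ) (x : ℤ → B) (i : ℤ) : shift^[k] x i = x (i + k) := by
  induction k generalizing x i with
  | zero => simp
  | succ k ih =>
    rw [Function.iterate_succ_apply, ih, shift]
    congr 1
    push_cast
    ring

theorem shift_injective : Function.Injective (shift : (ℤ → B) → ℤ → B) := fun x y h => by
  funext i
  simpa [shift] using congrFun h (i - 1)

/-- The set of all sequences in which the word `w` occurs at position `0`. -/
def wordCylinder (w : List B) : Set (ℤ → B) := {x | ∀ (i : ℕ) (h : i < w.length), x i = w[i]}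

theorem exists_mem_wordCylinder [Nonempty B] (u : List B) : (wordCylinder u).Nonempty := by
  obtain ⟨b⟩ := ‹Nonempty B›
  refine ⟨fun i => u.getD i.toNat b, fun i hi => ?_⟩
  simp [hi]

theorem shift_iterate_mem_wordCylinder_iff {z : ℤ → B} {u w : List B} (hz : z ∈ wordCylinder u)
    {k : ℕ} (hk : k + w.length ≤ u.length) :
    shift^[k] z ∈ wordCylinder w ↔ w <+: u.drop k := by
  rw [List.prefix_iff_getElem?]
  refine forall_congr' fun i => forall_congr' fun hi => ?_
  have hz' := hz (k + i) (by omega)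
  rw [List.getElem?_drop, List.getElem?_eq_getElem (by omega), shift_iterate_apply,
    Option.some_inj, ← hz']
  rw [show (i : ℤ) + k = ((k + i : ℕ) : ℤ) by push_cast; ring]

/-- Visits of the orbit of `z` to the cylinder and occurrences of `w` in `u` agree at every position
`k` with `k + w.length ≤ u.length`. At most `w.length` positions remain. -/
theorem sum_indicator_wordCylinder_bounds [DecidableEq B] {z : ℤ → B} {u : List B}
    (hz : z ∈ wordCylinder u) (w : List B) :
    (occurrences w u : ℝ) ≤
        ∑ k ∈ Finset.range u.length, (wordCylinder w).indicator 1 (shift^[k] z) + w.length ∧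
      ∑ k ∈ Finset.range u.length, (wordCylinder w).indicator (1 : (ℤ → B) → ℝ) (shift^[k] z) ≤
        occurrences w u + w.length := by
  have key : ∀ k, |((if w <+: u.drop k then 1 else 0) : ℝ) -
      (wordCylinder w).indicator 1 (shift^[k] z)| ≤
        ((if u.length < k + w.length then 1 else 0) : ℝ) := by
    intro k
    by_cases hk : k + w.length ≤ u.length
    · rw [if_neg (show ¬ u.length < k + w.length by omega)]
      by_cases h : w <+: u.drop k
      · rw [if_pos h, Set.indicator_of_mem ((shift_iterate_mem_wordCylinder_iff hz hk).mpr h)]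
        simp
      · rw [if_neg h,
          Set.indicator_of_notMem (mt (shift_iterate_mem_wordCylinder_iff hz hk).mp h)]
        simp
    · rw [if_pos (show u.length < k + w.length by omega)]
      by_cases h : shift^[k] z ∈ wordCylinder w
      · rw [Set.indicator_of_mem h]; split_ifs <;> simp
      · rw [Set.indicator_of_notMem h]; split_ifs <;> simp
  have hb : ∑ k ∈ Finset.range u.length, ((if u.length < k + w.length then 1 else 0) : ℝ)
      ≤ w.length := by
    rw [Finset.sum_boole]
    norm_cast
    -- Counting positions from the end of `u` injects the exceptional ones into `range w.length`.
    refine (Finset.card_le_card_of_injOn (t := Finset.range w.length)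
      (fun k => u.length - 1 - k) ?_ ?_).trans (by simp)
    · intro k hk
      simp only [Finset.coe_filter, Finset.mem_range, Set.mem_ofPred_eq, Finset.coe_range,
        Set.mem_Iio] at hk ⊢
      omega
    · intro k hk l hl h
      simp only [Finset.coe_filter, Finset.mem_range, Set.mem_ofPred_eq] at hk hl h
      omega
  have h := (Finset.abs_sum_le_sum_abs _ _).trans
    ((Finset.sum_le_sum fun k (_ : k ∈ Finset.range u.length) => key k).trans hb)
  rw [Finset.sum_sub_distrib, abs_le] at h
  have e : (occurrences w u : ℝ) =
      ∑ k ∈ Finset.range u.length, ((if w <+: u.drop k then 1 else 0) : ℝ) := by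
    simp [occurrences]
  rw [e]
  constructor <;> linarith [h.1, h.2]

theorem exists_orbit_measure [MeasurableSpace B] [Nonempty B] (u : List B) :
    ∃ (P : ProbabilityMeasure (ℤ → B)) (z : ℤ → B), z ∈ wordCylinder u ∧ ∀ E, MeasurableSet E →
      (P : Measure (ℤ → B)).real E * u.length =
        ∑ i ∈ Finset.range u.length, E.indicator (1 : (ℤ → B) → ℝ) (shift^[i] z) := by
  obtain ⟨z, hz⟩ := exists_mem_wordCylinder u
  -- For empty `u` both sides of the identity vanish and any probability measure will do.
  by_cases hu : u.length = 0
  · exact ⟨⟨Measure.dirac z, inferInstance⟩, z, hz, by simp [hu]⟩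
  have hu' : (u.length : ENNReal) ≠ 0 := by exact_mod_cast hu
  let m : Measure (ℤ → B) := (u.length : ENNReal)⁻¹ •
    ∑ i ∈ Finset.range u.length, Measure.dirac (shift^[i] z)
  have hm : IsProbabilityMeasure m := ⟨by
    simp only [m, Measure.smul_apply, Measure.finsetSum_apply, measure_univ, Finset.sum_const,
      Finset.card_range, nsmul_eq_mul, mul_one, smul_eq_mul]
    exact ENNReal.inv_mul_cancel hu' (by simp)⟩
  refine ⟨⟨m, hm⟩, z, hz, fun E hE => ?_⟩
  simp only [ProbabilityMeasure.coe_mk, Measure.real, m, Measure.smul_apply,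
    Measure.finsetSum_apply, smul_eq_mul, ENNReal.toReal_mul, ENNReal.toReal_inv,
    ENNReal.toReal_natCast]
  rw [ENNReal.toReal_sum (fun _ _ => measure_ne_top _ _), mul_comm, ← mul_assoc, mul_inv_cancel₀ (by exact_mod_cast hu),
    one_mul]
  refine Finset.sum_congr rfl fun i _ => ?_
  rw [Measure.dirac_apply' _ hE]
  by_cases h : shift^[i] z ∈ E <;> simp [h]

variable [TopologicalSpace B]

theorem continuous_shift : Continuous (shift : (ℤ → B) → ℤ → B) :=
  continuous_pi fun i => continuous_apply (i + 1)

variable [DiscreteTopology B]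

theorem isClopen_wordCylinder (w : List B) : IsClopen (wordCylinder w) := by
  have : wordCylinder w = ⋂ i : Fin w.length, (fun x : ℤ → B => x (i : ℕ)) ⁻¹' {w[i]} := by
    ext x
    simp only [wordCylinder, Set.mem_ofPred_eq, Set.mem_iInter, Set.mem_preimage,
      Set.mem_singleton_iff]
    exact ⟨fun h i => h i i.2, fun h i hi => h ⟨i, hi⟩⟩
  rw [this]
  exact isClopen_iInter_of_finite fun i => (isClopen_discrete _).preimage (continuous_apply _)

variable [MeasurableSpace B]

/-- Clopen sets have empty boundary, so weak limits control their measures; they include the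
measurable cylinders, which form a generating π-system. -/
theorem Measure.ext_of_isClopen {μ ν : Measure (ℤ → B)} [IsFiniteMeasure μ] [IsFiniteMeasure ν]
    (h : ∀ E, IsClopen E → μ E = ν E) : μ = ν := by
  refine ext_of_generate_finite (measurableCylinders fun _ : ℤ => B)
    generateFrom_measurableCylinders.symm isPiSystem_measurableCylinders (fun s hs => ?_)
    (h _ isClopen_univ)
  obtain ⟨I, S, hS, rfl⟩ := (mem_measurableCylinders _).mp hs
  exact h _ ((isClopen_discrete S).preimage (by fun_prop))

variable [BorelSpace B] [Finite B]

theorem measurable_shift : Measurable (shift : (ℤ → B) → ℤ → B) := continuous_shift.measurable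

/-- Invariant measures that agree on the cylinders at position `0` are equal. -/
theorem Measure.ext_of_wordCylinder {μ ν : Measure (ℤ → B)} [IsFiniteMeasure μ]
    [IsFiniteMeasure ν] (hμ : MeasurePreserving shift μ μ) (hν : MeasurePreserving shift ν ν)
    (h : ∀ w : List B, μ (wordCylinder w) = ν (wordCylinder w)) : μ = ν := by
  have hproj : ∀ l : ℕ, μ.map (fun x (i : Fin l) => x (i : ℕ)) =
      ν.map (fun x (i : Fin l) => x (i : ℕ)) := by
    intro l
    have hm : Measurable fun (x : ℤ → B) (i : Fin l) => x (i : ℕ) := by fun_prop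
    refine Measure.ext_of_singleton fun f => ?_
    rw [Measure.map_apply hm (measurableSet_singleton f),
      Measure.map_apply hm (measurableSet_singleton f)]
    convert h (List.ofFn f) using 2 <;>
    · ext x
      simp only [wordCylinder, Set.mem_preimage, Set.mem_singleton_iff, List.length_ofFn,
        List.getElem_ofFn, Set.mem_ofPred_eq, funext_iff]
      exact ⟨fun h i hi => h ⟨i, hi⟩, fun h i => h i i.2⟩
  refine ext_of_generate_finite (measurableCylinders fun _ : ℤ => B)
    generateFrom_measurableCylinders.symm isPiSystem_measurableCylinders (fun s hs => ?_)
    (by simpa [wordCylinder] using h [])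
  have hms : MeasurableSet s := MeasurableSet.of_mem_measurableCylinders hs
  obtain ⟨I, S, hS, rfl⟩ := (mem_measurableCylinders _).mp hs
  -- Shifting by `r` moves all coordinates in `I` into `[0, 2r)`, where the words at position `0`
  -- decide.
  obtain ⟨r, hr⟩ : ∃ r : ℕ, ∀ i ∈ I, -(r : ℤ) ≤ i ∧ i < r := by
    refine ⟨∑ i ∈ I, (i.natAbs + 1), fun i hi => ?_⟩
    have := Finset.single_le_sum (f := fun i : ℤ => i.natAbs + 1) (fun _ _ => Nat.zero_le _) hi
    omega
  have hS' : MeasurableSet ((fun (f : Fin (2 * r) → B) (i : I) =>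
      f ⟨((i : ℤ) + r).toNat, by have := hr i i.2; omega⟩) ⁻¹' S) :=
    (Set.toFinite _).measurableSet
  have hm : Measurable fun (x : ℤ → B) (i : Fin (2 * r)) => x (i : ℕ) := by fun_prop
  rw [← (hμ.iterate r).measure_preimage hms.nullMeasurableSet,
    ← (hν.iterate r).measure_preimage hms.nullMeasurableSet]
  have e : shift^[r] ⁻¹' (cylinder I S) =
      (fun (x : ℤ → B) (i : Fin (2 * r)) => x (i : ℕ)) ⁻¹' ((fun (f : Fin (2 * r) → B) (i : I) =>
      f ⟨((i : ℤ) + r).toNat, by have := hr i i.2; omega⟩) ⁻¹' S) := by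
    ext x
    simp only [Set.mem_preimage, mem_cylinder]
    have : I.restrict (shift^[r] x) = fun i : I => x (((i : ℤ) + r).toNat : ℕ) := by
      funext i
      have := hr i i.2
      simp only [Finset.restrict, shift_iterate_apply]
      congr 1
      omega
    rw [this]
  rw [e, ← Measure.map_apply hm hS', ← Measure.map_apply hm hS', hproj]

/-- The limit is a weak limit of the orbit measures along `u N`, by compactness of the space of
probability measures. An ultrafilter replaces the choice of a subsequence, so that several such
limits can be compared along the same filter. -/
theorem exists_invariant_limit [DecidableEq B] [Nonempty B] (u : ℕ → List B) (U : Ultrafilter ℕ)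
    (hu : Tendsto (fun N => (u N).length) U atTop) :
    ∃ ν : Measure (ℤ → B), IsProbabilityMeasure ν ∧ MeasurePreserving shift ν ν ∧
      ∀ w, Tendsto (fun N => (occurrences w (u N) : ℝ) / (u N).length) U
        (𝓝 (ν.real (wordCylinder w))) := by
  choose P z hz hP using fun N => exists_orbit_measure (u N)
  obtain ⟨ν, -, hν⟩ := isCompact_univ.ultrafilter_le_nhds (U.map P) (by simp)
  have hν' : Tendsto P U (𝓝 ν) := hν
  have hlim : ∀ E : Set (ℤ → B), IsClopen E →
      Tendsto (fun N => (P N : Measure (ℤ → B)).real E) U (𝓝 ((ν : Measure (ℤ → B)).real E)) := by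
    intro E hE
    have := ProbabilityMeasure.tendsto_measure_of_null_frontier_of_tendsto' hν' (E := E)
      (by simp [hE.frontier_eq])
    exact (ENNReal.tendsto_toReal (measure_ne_top _ _)).comp this
  have hinv : Tendsto (fun N => ((u N).length : ℝ)⁻¹) U (𝓝 0) :=
    tendsto_inv_atTop_zero.comp (tendsto_natCast_atTop_atTop.comp hu)
  have hpos : ∀ᶠ N in U, (0 : ℝ) < (u N).length := by
    filter_upwards [hu.eventually (eventually_gt_atTop 0)] with N hN
    exact_mod_cast hN
  -- An error bounded independently of `N` disappears after division by the length.
  have hclose : ∀ (f : ℕ → ℝ) (c : ℝ) (E : Set (ℤ → B)), IsClopen E →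
      (∀ N, |f N - (P N : Measure (ℤ → B)).real E * (u N).length| ≤ c) →
      Tendsto (fun N => f N / (u N).length) U (𝓝 ((ν : Measure (ℤ → B)).real E)) := by
    intro f c E hE hf
    have h0 : Tendsto (fun N => f N / (u N).length - (P N : Measure (ℤ → B)).real E) U (𝓝 0) := by
      refine squeeze_zero_norm' (a := fun N => c * ((u N).length : ℝ)⁻¹) ?_
        (by simpa using hinv.const_mul c)
      filter_upwards [hpos] with N hN
      rw [Real.norm_eq_abs, div_sub' hN.ne', abs_div, abs_of_pos hN, ← div_eq_mul_inv]
      refine div_le_div_of_nonneg_right ?_ hN.le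
      rw [mul_comm ((u N).length : ℝ)]
      exact hf N
    simpa using h0.add (hlim E hE)
  refine ⟨ν, inferInstance, ⟨measurable_shift, ?_⟩, fun w => ?_⟩
  · have : IsProbabilityMeasure ((ν : Measure (ℤ → B)).map shift) :=
      Measure.isProbabilityMeasure_map measurable_shift.aemeasurable
    refine Measure.ext_of_isClopen fun E hE => ?_
    rw [Measure.map_apply measurable_shift hE.isOpen.measurableSet]
    have h1 := hlim _ (hE.preimage continuous_shift)
    -- The orbit sums of `E` and of its preimage telescope to a difference of two indicator values,
    -- whence the bound `1`.
    have h2 := hclose (fun N => (P N : Measure (ℤ → B)).real (shift ⁻¹' E) * (u N).length) 1 E hE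
      fun N => by
        rw [hP N _ hE.isOpen.measurableSet, hP N _ (hE.preimage continuous_shift).isOpen.measurableSet]
        have e : ∀ i, (shift ⁻¹' E).indicator (1 : (ℤ → B) → ℝ) (shift^[i] (z N)) =
            E.indicator 1 (shift^[i + 1] (z N)) := fun i => by
          rw [Function.iterate_succ_apply']
          rfl
        simp only [e]
        rw [← Finset.sum_sub_distrib, Finset.sum_range_sub fun i => E.indicator (1 : (ℤ → B) → ℝ) (shift^[i] (z N))]
        have hb : ∀ x, E.indicator (1 : (ℤ → B) → ℝ) x ∈ Set.Icc (0 : ℝ) 1 := fun x => by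
          by_cases h : x ∈ E <;> simp [h]
        rw [abs_le]
        constructor <;> linarith [(hb (shift^[(u N).length] (z N))).1,
          (hb (shift^[(u N).length] (z N))).2, (hb (shift^[0] (z N))).1,
          (hb (shift^[0] (z N))).2]
    have h3 := h1.congr' (f₂ := fun N => (P N : Measure (ℤ → B)).real (shift ⁻¹' E) *
      (u N).length / (u N).length) (by
        filter_upwards [hpos] with N hN
        rw [mul_div_cancel_right₀ _ hN.ne'])
    exact (measureReal_eq_measureReal_iff).mp (tendsto_nhds_unique h3 h2)
  · refine hclose _ w.length _ (isClopen_wordCylinder w) fun N => ?_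
    have := sum_indicator_wordCylinder_bounds (hz N) w
    rw [hP N _ (isClopen_wordCylinder w).isOpen.measurableSet, abs_le]
    constructor <;> linarith [this.1, this.2]

end SequenceSpace

/-! ### The action of a morphism on two-sided sequences. -/

section SequenceMap

theorem exists_between_of_lt_succ {p : ℤ → ℤ} (h0 : p 0 = 0) (hp : ∀ i, p i < p (i + 1)) (t : ℤ) :
    ∃ i, p i ≤ t ∧ t < p (i + 1) := by
  induction t using Int.induction_on with
  | zero => exact ⟨0, h0.le, by have := hp 0; rwa [h0] at this⟩
  | succ t ih =>
    obtain ⟨i, hi, hi'⟩ := ih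
    by_cases h : (t : ℤ) + 1 < p (i + 1)
    · exact ⟨i, by omega, h⟩
    · exact ⟨i + 1, by omega, by have := hp (i + 1); omega⟩
  | pred t ih =>
    obtain ⟨i, hi, hi'⟩ := ih
    by_cases h : p i ≤ -(t : ℤ) - 1
    · exact ⟨i, h, by omega⟩
    · refine ⟨i - 1, ?_, by rw [sub_add_cancel]; omega⟩
      have := hp (i - 1)
      rw [sub_add_cancel] at this
      omega

variable {A B : Type*} {σ : FreeMonoid A →* FreeMonoid B}

theorem IsImage.mem_wordCylinder {x : ℤ → A} {y : ℤ → B} (h : IsImage σ x y) :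
    y ∈ wordCylinder (letterImage σ (x 0)) := by
  obtain ⟨p, h0, -, hy⟩ := h
  intro i hi
  simpa [h0] using hy 0 i hi

theorem IsImage.shift {x : ℤ → A} {y : ℤ → B} (h : IsImage σ x y) :
    IsImage σ (shift x) (_root_.shift^[(letterImage σ (x 0)).length] y) := by
  obtain ⟨p, h0, hp, hy⟩ := h
  have h1 := hp 0
  rw [zero_add, h0, zero_add] at h1
  refine ⟨fun i => p (i + 1) - (letterImage σ (x 0)).length, ?_, fun i => ?_, fun i j hj => ?_⟩
  · simp [h1]
  · simp only [_root_.shift]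
    rw [hp (i + 1)]
    ring
  · rw [shift_iterate_apply]
    refine Eq.trans ?_ (hy (i + 1) j hj)
    congr 1
    ring

/-- The map on two-sided sequences defined by a nonerasing morphism. -/
noncomputable def seqMap (σ : FreeMonoid A →* FreeMonoid B) (hσ : IsNonerasing σ) (x : ℤ → A) :
    ℤ → B :=
  (IsImage.existsUnique σ hσ x).choose

theorem isImage_seqMap (hσ : IsNonerasing σ) (x : ℤ → A) : IsImage σ x (seqMap σ hσ x) :=
  (IsImage.existsUnique σ hσ x).choose_spec.1

theorem isImage_iff_eq_seqMap (hσ : IsNonerasing σ) {x : ℤ → A} {y : ℤ → B} :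
    IsImage σ x y ↔ y = seqMap σ hσ x :=
  ⟨fun h => (IsImage.existsUnique σ hσ x).unique h (isImage_seqMap hσ x),
    fun h => h ▸ isImage_seqMap hσ x⟩

theorem seqMap_shift (hσ : IsNonerasing σ) (x : ℤ → A) :
    seqMap σ hσ (shift x) = shift^[(letterImage σ (x 0)).length] (seqMap σ hσ x) :=
  ((isImage_iff_eq_seqMap hσ).mp (isImage_seqMap hσ x).shift).symm

/-- Each cut `p x i` is a finite sum of lengths, hence continuous in `x`. The coordinate `t` of the
image is determined by the cut before it and the letter read there, both locally constant. -/
theorem continuous_seqMap [TopologicalSpace A] [DiscreteTopology A] [TopologicalSpace B]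
    [DiscreteTopology B] (hσ : IsNonerasing σ) : Continuous (seqMap σ hσ) := by
  choose p h0 hp hy using isImage_seqMap hσ
  have hlen : ∀ i, Continuous fun x : ℤ → A => ((letterImage σ (x i)).length : ℤ) := fun i =>
    (continuous_of_discreteTopology (f := fun a => ((letterImage σ a).length : ℤ))).comp
      (continuous_apply i)
  have hpc : ∀ i, Continuous fun x => p x i := by
    intro i
    induction i using Int.induction_on with
    | zero => simp only [h0]; exact continuous_const
    | succ i ih => simp only [hp]; exact ih.add (hlen _)
    | pred i ih =>
      have : (fun x => p x (-(i : ℤ) - 1)) =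
          fun x => p x (-i) - ((letterImage σ (x (-(i : ℤ) - 1))).length : ℤ) := by
        funext x
        have := hp x (-(i : ℤ) - 1)
        rw [sub_add_cancel] at this
        omega
      rw [this]
      exact ih.sub (hlen _)
  refine continuous_pi fun t => (IsLocallyConstant.iff_exists_open _).mpr (fun x => ?_) |>.continuous
  obtain ⟨i, hi, hi'⟩ := exists_between_of_lt_succ (h0 x)
    (fun i => by have := hp x i; have := hσ.length_pos (x i); omega) t
  rw [hp] at hi'
  have hj : (t - p x i).toNat < (letterImage σ (x i)).length := by omega
  refine ⟨(fun z => p z i) ⁻¹' {p x i} ∩ (fun z : ℤ → A => z i) ⁻¹' {x i},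
    ((isOpen_discrete _).preimage (hpc i)).inter
      ((isOpen_discrete _).preimage (continuous_apply i)), ⟨rfl, rfl⟩, ?_⟩
  rintro z ⟨hz, hz'⟩
  simp only [Set.mem_preimage, Set.mem_singleton_iff] at hz hz'
  have ht : t = p x i + (t - p x i).toNat := by omega
  have h1 := hy x i _ hj
  have h2 := hy z i (t - p x i).toNat (by rw [hz']; exact hj)
  rw [← ht] at h1
  rw [hz, ← ht] at h2
  rw [h1, h2]
  simp only [hz']

end SequenceMap

/-! ### Towers of level `n` and invariant measures. -/

namespace DirectiveSequence

variable {A : ℕ → Type*} {τ : DirectiveSequence A}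

theorem window_eq_ofFn {B : Type*} (x : ℤ → B) (m : ℤ) (l : ℕ) :
    window x m l = FreeMonoid.ofList (List.ofFn fun j : Fin l => x (m + j)) := by
  unfold window
  congr 1
  simp only [List.bind_eq_flatMap, List.pure_def, ← List.map_eq_flatMap]
  apply List.ext_getElem <;> simp

theorem isClopen_window_mem {B : Type*} [TopologicalSpace B] [DiscreteTopology B] (m : ℤ) (l : ℕ)
    (L : Set (FreeMonoid B)) : IsClopen {x : ℤ → B | window x m l ∈ L} := by
  simp only [window_eq_ofFn]
  exact (isClopen_discrete {f : Fin l → B | FreeMonoid.ofList (List.ofFn f) ∈ L}).preimage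
    (f := fun (x : ℤ → B) (j : Fin l) => x (m + j)) (by fun_prop)

theorem isClosed_levelShift (τ : DirectiveSequence A) (n : ℕ) [TopologicalSpace (A n)]
    [DiscreteTopology (A n)] : IsClosed (τ.levelShift n) := by
  simp only [levelShift, Set.ofPred_forall]
  exact isClosed_iInter fun m => isClosed_iInter fun l => (isClopen_window_mem m l _).isClosed

theorem base_eq_image (hτ : τ.Nonerasing) (n : ℕ) (a : A n) :
    τ.base n a = seqMap _ (hτ.block (Nat.zero_le n)) '' (τ.levelShift n ∩ {y | y 0 = a}) := by
  ext x
  simp only [base, isImage_iff_eq_seqMap (hτ.block (Nat.zero_le n)), Set.mem_ofPred_eq,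
    Set.mem_image, Set.mem_inter_iff, and_assoc, eq_comm]

theorem base_subset_wordCylinder (n : ℕ) (a : A n) :
    τ.base n a ⊆ wordCylinder (letterImage (τ.block (Nat.zero_le n)) a) := by
  rintro x ⟨y, -, rfl, h⟩
  exact h.mem_wordCylinder

theorem Nonerasing.height_pos (hτ : τ.Nonerasing) (n : ℕ) (a : A n) : 0 < τ.height n a :=
  (hτ.block (Nat.zero_le n)).length_pos a

variable [∀ n, Fintype (A n)] [TopologicalSpace (A 0)] [DiscreteTopology (A 0)]

/-- The bases and floors are forward images under continuous maps; compactness is what makes them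
measurable. -/
theorem isCompact_base (hτ : τ.Nonerasing) (n : ℕ) (a : A n) : IsCompact (τ.base n a) := by
  let : TopologicalSpace (A n) := ⊥
  have : DiscreteTopology (A n) := ⟨rfl⟩
  rw [base_eq_image hτ]
  exact ((τ.isClosed_levelShift n).inter
    (isClosed_singleton.preimage (continuous_apply (A := fun _ : ℤ => A n) 0))).isCompact.image
    (continuous_seqMap _)

variable [MeasurableSpace (A 0)] [BorelSpace (A 0)]

theorem measurableSet_shift_image_base (hτ : τ.Nonerasing) (n : ℕ) (a : A n) (k : ℕ) :
    MeasurableSet (shift^[k] '' τ.base n a) :=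
  ((isCompact_base hτ n a).image (continuous_shift.iterate k)).isClosed.measurableSet

theorem measurableSet_base (hτ : τ.Nonerasing) (n : ℕ) (a : A n) :
    MeasurableSet (τ.base n a) :=
  (isCompact_base hτ n a).isClosed.measurableSet

/-- The floors partition the subshift, and invariance together with injectivity of the shift carries
the part of `E` in floor `k` back to the base. -/
theorem Recognizable.measureReal_eq_sum (hrec : τ.Recognizable) (hτ : τ.Nonerasing)
    {μ : Measure (ℤ → A 0)} [IsFiniteMeasure μ] (hμ : MeasurePreserving shift μ μ)
    (hX : μ (τ.subshift)ᶜ = 0) (n : ℕ) {E : Set (ℤ → A 0)} (hE : MeasurableSet E) :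
    μ.real E = ∑ a, ∑ k ∈ Finset.range (τ.height n a),
      μ.real (τ.base n a ∩ shift^[k] ⁻¹' E) := by
  have hsc : ∀ (a : A n) (k : ℕ), μ.real (τ.base n a ∩ shift^[k] ⁻¹' E) =
      μ.real (shift^[k] '' τ.base n a ∩ E) := by
    intro a k
    have hm : MeasurableSet (shift^[k] '' τ.base n a ∩ E) :=
      (measurableSet_shift_image_base hτ n a k).inter hE
    rw [Measure.real, Measure.real, ← (hμ.iterate k).measure_preimage hm.nullMeasurableSet,
      Set.preimage_inter, Set.preimage_image_eq _ (shift_injective.iterate k)]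
  simp only [hsc]
  have h1 : μ E = μ (⋃ i : Σ a : A n, Fin (τ.height n a),
      (shift^[i.2] '' τ.base n i.1 ∩ E)) := by
    rw [← Set.iUnion_inter, (hrec n).1, Set.inter_comm]
    exact (measure_inter_conull hX).symm
  rw [measure_iUnion (fun i j hij => ((hrec n).2 hij).mono Set.inter_subset_left
    Set.inter_subset_left) (fun i => (measurableSet_shift_image_base hτ n _ _).inter hE),
    tsum_fintype, Fintype.sum_sigma] at h1
  rw [Measure.real, h1, ENNReal.toReal_sum (fun a _ => by
    exact ENNReal.sum_ne_top.mpr fun _ _ => measure_ne_top _ _)]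
  refine Finset.sum_congr rfl fun a _ => ?_
  rw [ENNReal.toReal_sum (fun _ _ => measure_ne_top _ _),
    Finset.sum_range fun k => μ.real (shift^[k] '' τ.base n a ∩ E)]
  rfl

/-- The masses of the towers: these are the weights in the averages over letters below. -/
theorem Recognizable.sum_measureReal_base_mul_height (hrec : τ.Recognizable) (hτ : τ.Nonerasing)
    {μ : Measure (ℤ → A 0)} [IsProbabilityMeasure μ] (hμ : MeasurePreserving shift μ μ)
    (hX : μ (τ.subshift)ᶜ = 0) (n : ℕ) :
    ∑ a, μ.real (τ.base n a) * τ.height n a = 1 := by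
  have := hrec.measureReal_eq_sum hτ hμ hX n MeasurableSet.univ
  simp only [probReal_univ, Set.preimage_univ, Set.inter_univ, Finset.sum_const,
    Finset.card_range, nsmul_eq_mul] at this
  simp only [this, mul_comm]

/-- The measure of a cylinder is the mean number of occurrences of its word in the towers of level
`n`, up to the occurrences that straddle the top of a tower. -/
theorem Recognizable.abs_measureReal_wordCylinder_sub_le [∀ n, DecidableEq (A n)]
    (hrec : τ.Recognizable) (hτ : τ.Nonerasing)
    {μ : Measure (ℤ → A 0)} [IsProbabilityMeasure μ] (hμ : MeasurePreserving shift μ μ)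
    (hX : μ (τ.subshift)ᶜ = 0) (n : ℕ) (w : List (A 0)) :
    |μ.real (wordCylinder w) - ∑ a, μ.real (τ.base n a) *
        occurrences w (letterImage (τ.block (Nat.zero_le n)) a)| ≤
      w.length * ∑ a, μ.real (τ.base n a) := by
  have hw : MeasurableSet (wordCylinder w) := (isClopen_wordCylinder w).isOpen.measurableSet
  rw [hrec.measureReal_eq_sum hτ hμ hX n hw, ← Finset.sum_sub_distrib, Finset.mul_sum]
  refine (Finset.abs_sum_le_sum_abs _ _).trans (Finset.sum_le_sum fun a _ => ?_)
  have hi : ∀ k, Integrable (fun x => (wordCylinder w).indicator (1 : (ℤ → A 0) → ℝ)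
      (shift^[k] x)) (μ.restrict (τ.base n a)) := fun k => by
    refine Integrable.of_bound (C := 1) ((measurable_one.indicator hw).comp
      (measurable_shift.iterate k)).aestronglyMeasurable (ae_of_all _ fun x => ?_)
    by_cases h : shift^[k] x ∈ wordCylinder w <;> simp [h]
  have h1 : ∀ k, ∫ x in τ.base n a, (wordCylinder w).indicator (1 : (ℤ → A 0) → ℝ)
      (shift^[k] x) ∂μ = μ.real (τ.base n a ∩ shift^[k] ⁻¹' wordCylinder w) := fun k => by
    have : (fun x => (wordCylinder w).indicator (1 : (ℤ → A 0) → ℝ) (shift^[k] x)) =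
      (shift^[k] ⁻¹' wordCylinder w).indicator 1 := rfl
    have hm := measurable_shift.iterate k hw
    rw [this, integral_indicator_one hm, measureReal_restrict_apply hm, Set.inter_comm]
  -- The difference is an integral over the base of visits minus occurrences. All points of the base
  -- begin with the same word `τ_{[0,n)}(a)`, so the integrand is at most `w.length` in absolute
  -- value.
  have h2 : ∑ k ∈ Finset.range (τ.height n a), μ.real (τ.base n a ∩ shift^[k] ⁻¹' wordCylinder w) -
      μ.real (τ.base n a) * occurrences w (letterImage (τ.block (Nat.zero_le n)) a) =
      ∫ x in τ.base n a, (∑ k ∈ Finset.range (τ.height n a),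
        (wordCylinder w).indicator (1 : (ℤ → A 0) → ℝ) (shift^[k] x) -
        (occurrences w (letterImage (τ.block (Nat.zero_le n)) a) : ℝ)) ∂μ := by
    rw [integral_sub (integrable_finsetSum _ fun k _ => hi k) (integrable_const _),
      integral_finsetSum _ fun k _ => hi k, setIntegral_const, smul_eq_mul]
    simp only [h1]
  rw [h2, ← Real.norm_eq_abs]
  refine norm_setIntegral_le_of_norm_le_const (measure_lt_top _ _) fun x hx => ?_
  have := sum_indicator_wordCylinder_bounds (base_subset_wordCylinder n a hx) w
  rw [Real.norm_eq_abs, abs_le]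
  change _ ≤ ∑ k ∈ Finset.range (τ.height n a), _ + _ ∧
    ∑ k ∈ Finset.range (τ.height n a), _ ≤ _ at this
  constructor <;> linarith [this.1, this.2]

/-- Average the hypothesis over the towers, whose masses sum to one: `3 * ε` comes from the
frequencies and another `ε` from occurrences straddling the top of a tower. -/
theorem Recognizable.abs_measureReal_sub_le [∀ n, DecidableEq (A n)] (hrec : τ.Recognizable) (hτ : τ.Nonerasing)
    {μ : Measure (ℤ → A 0)} [IsProbabilityMeasure μ] (hμ : MeasurePreserving shift μ μ)
    (hX : μ (τ.subshift)ᶜ = 0) (w : List (A 0)) {ε α : ℝ} {N : ℕ}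
    (h : ∀ b : A N, |occurrences w (letterImage (τ.block (Nat.zero_le N)) b) - α * τ.height N b| ≤
        3 * ε * τ.height N b ∧ w.length ≤ ε * τ.height N b) :
    |μ.real (wordCylinder w) - α| ≤ 4 * ε := by
  have h1 := hrec.abs_measureReal_wordCylinder_sub_le hτ hμ hX N w
  have h2 := hrec.sum_measureReal_base_mul_height hτ hμ hX N
  have h3 : w.length * ∑ a, μ.real (τ.base N a) ≤ ε := by
    rw [Finset.mul_sum, ← mul_one ε, ← h2, Finset.mul_sum]
    refine Finset.sum_le_sum fun a _ => ?_
    have := mul_le_mul_of_nonneg_left (h a).2 (measureReal_nonneg (μ := μ) (s := τ.base N a))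
    linarith
  have h4 : |∑ a, μ.real (τ.base N a) *
      occurrences w (letterImage (τ.block (Nat.zero_le N)) a) - α| ≤ 3 * ε := by
    rw [← mul_one α, ← mul_one (3 * ε), ← h2, Finset.mul_sum, Finset.mul_sum,
      ← Finset.sum_sub_distrib]
    refine (Finset.abs_sum_le_sum_abs _ _).trans (Finset.sum_le_sum fun a _ => ?_)
    rw [mul_left_comm, ← mul_sub, abs_mul, abs_of_nonneg measureReal_nonneg, mul_left_comm (3 * ε)]
    exact mul_le_mul_of_nonneg_left (h a).1 measureReal_nonneg
  have := abs_sub_le (μ.real (wordCylinder w)) (∑ a, μ.real (τ.base N a) *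
      occurrences w (letterImage (τ.block (Nat.zero_le N)) a)) α
  linarith

end DirectiveSequence

/-! ### Lifting invariant measures from level `n` to the subshift. -/

namespace DirectiveSequence

variable {A : ℕ → Type*} {τ : DirectiveSequence A}

section Lift

theorem Recognizable.shift_mem (hrec : τ.Recognizable) {n : ℕ} {a : A n} {k : ℕ}
    (hk : k < τ.height n a) {x : ℤ → A 0} (hx : x ∈ τ.base n a) : shift^[k] x ∈ τ.subshift := by
  rw [← (hrec n).1]
  exact Set.mem_iUnion.mpr ⟨⟨a, k, hk⟩, x, hx, rfl⟩

theorem Recognizable.eq_of_shift_mem_base (hrec : τ.Recognizable) (hτ : τ.Nonerasing) {n : ℕ}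
    {a b : A n} {k : ℕ} (hk : k < τ.height n a) {x : ℤ → A 0} (hx : x ∈ τ.base n a)
    (hx' : shift^[k] x ∈ τ.base n b) : a = b ∧ k = 0 := by
  by_contra hne
  have : (⟨a, k, hk⟩ : Σ a : A n, Fin (τ.height n a)) ≠ ⟨b, 0, hτ.height_pos n b⟩ := by
    intro h
    rw [Sigma.mk.injEq] at h
    obtain ⟨rfl, h⟩ := h
    exact hne ⟨rfl, by simpa using h⟩
  exact Set.disjoint_left.mp ((hrec n).2 this) ⟨x, hx, rfl⟩ ⟨_, hx', rfl⟩

variable [∀ n, Fintype (A n)] [TopologicalSpace (A 0)] [DiscreteTopology (A 0)]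
  [MeasurableSpace (A 0)] [BorelSpace (A 0)]

/-- An invariant measure on the shift of level `n` lifts to an invariant measure on the subshift
that gives to the base of a tower the measure of the corresponding letter. -/
theorem Recognizable.exists_lift (hrec : τ.Recognizable) (hτ : τ.Nonerasing) (n : ℕ)
    [TopologicalSpace (A n)] [DiscreteTopology (A n)] [MeasurableSpace (A n)] [BorelSpace (A n)]
    {ν : Measure (ℤ → A n)} [IsFiniteMeasure ν] (hν : MeasurePreserving shift ν ν)
    (hX : ν (τ.levelShift n)ᶜ = 0) :
    ∃ μ : Measure (ℤ → A 0), IsFiniteMeasure μ ∧ MeasurePreserving shift μ μ ∧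
      μ (τ.subshift)ᶜ = 0 ∧ ∀ a, μ (τ.base n a) = ν {y | y 0 = a} := by
  classical
  set σ := τ.block (Nat.zero_le n)
  have hσ : IsNonerasing σ := hτ.block _
  let T := seqMap σ hσ
  have hT : Measurable T := (continuous_seqMap hσ).measurable
  let C : A n → Set (ℤ → A n) := fun a => {y | y 0 = a}
  have hC : ∀ a, MeasurableSet (C a) := fun a =>
    measurableSet_singleton a |>.preimage (measurable_pi_apply (X := fun _ : ℤ => A n) 0)
  have hsum : ∀ E, MeasurableSet E → ∑ a, ν (C a ∩ E) = ν E := by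
    intro E hE
    have : E = ⋃ a, C a ∩ E := by
      ext y; simp [C]
    conv_rhs => rw [this]
    rw [measure_iUnion (fun a b hab => ?_) (fun a => (hC a).inter hE), tsum_fintype]
    refine Set.disjoint_left.mpr fun y hy hy' => hab ?_
    rw [← hy.1, ← hy'.1]
  have hbase : ∀ {a y}, y ∈ C a → y ∈ τ.levelShift n → T y ∈ τ.base n a := fun h h' =>
    ⟨_, h', h, isImage_seqMap hσ _⟩
  have hcon : ∀ E, ν (E ∩ τ.levelShift n) = ν E := fun E => measure_inter_conull hX
  -- Floor `k` over the letter `a` receives a copy of `ν` restricted to `[a]`; the total mass need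
  -- not be one.
  let μ : Measure (ℤ → A 0) := ∑ a, ∑ k ∈ Finset.range (τ.height n a),
    (ν.restrict (C a)).map (shift^[k] ∘ T)
  have hμ : ∀ E, MeasurableSet E → μ E = ∑ a, ∑ k ∈ Finset.range (τ.height n a),
      ν (C a ∩ T ⁻¹' (shift^[k] ⁻¹' E)) := by
    intro E hE
    simp only [μ, Measure.finsetSum_apply]
    refine Finset.sum_congr rfl fun a _ => Finset.sum_congr rfl fun k _ => ?_
    have hm := (measurable_shift (B := A 0)).iterate k
    rw [Measure.map_apply (hm.comp hT) hE, Measure.restrict_apply ((hm.comp hT) hE),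
      Set.inter_comm, Set.preimage_comp]
  have hXm : MeasurableSet (τ.subshift) := (τ.isClosed_levelShift 0).measurableSet
  have hfin : IsFiniteMeasure μ := ⟨by
    rw [hμ _ MeasurableSet.univ]
    exact ENNReal.sum_lt_top.mpr fun _ _ => ENNReal.sum_lt_top.mpr fun _ _ => measure_lt_top _ _⟩
  refine ⟨μ, hfin, ⟨measurable_shift, Measure.ext fun E hE => ?_⟩, ?_, fun b => ?_⟩
  · rw [Measure.map_apply measurable_shift hE, hμ _ (measurable_shift hE), hμ _ hE]
    have e1 : ∑ a, ν (C a ∩ T ⁻¹' (shift^[0] ⁻¹' E)) = ν (T ⁻¹' E) := hsum _ (hT hE)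
    -- Climbing a whole tower is one shift at level `n` (`seqMap_shift`), so invariance of `ν` makes
    -- the floors just above the tops weigh as much as the bottom floors.
    have e2 : ∑ a, ν (C a ∩ T ⁻¹' (shift^[τ.height n a] ⁻¹' E)) = ν (T ⁻¹' E) := by
      rw [← hν.measure_preimage (hT hE).nullMeasurableSet,
        ← hsum _ (measurable_shift (hT hE))]
      refine Finset.sum_congr rfl fun a _ => congrArg ν ?_
      ext y
      simp only [Set.mem_inter_iff, Set.mem_preimage]
      refine and_congr_right fun hy => ?_
      have hy' : y 0 = a := hy
      have := seqMap_shift hσ y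
      rw [hy'] at this
      change _ ↔ seqMap σ hσ (shift y) ∈ E
      rw [this]
      rfl
    -- Adding the same finite mass to both sides, written as bottom floors on one and as floors
    -- above the tops on the other, gives the sums over `0, ..., height` on both.
    rw [← ENNReal.add_left_inj (measure_ne_top ν (T ⁻¹' E))]
    nth_rewrite 1 [← e1]
    rw [← e2, ← Finset.sum_add_distrib, ← Finset.sum_add_distrib]
    refine Finset.sum_congr rfl fun a _ => ?_
    rw [← Finset.sum_range_succ fun k => ν (C a ∩ T ⁻¹' (shift^[k] ⁻¹' E)),
      Finset.sum_range_succ']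
    simp only [Function.iterate_succ', Set.preimage_comp]
  · rw [hμ _ hXm.compl]
    refine Finset.sum_eq_zero fun a _ => Finset.sum_eq_zero fun k hk => ?_
    rw [← hcon]
    convert measure_empty (μ := ν)
    refine Set.eq_empty_of_forall_notMem fun y hy => hy.1.2 ?_
    exact hrec.shift_mem (Finset.mem_range.mp hk) (hbase hy.1.1 hy.2)
  -- By disjointness only floor `0` over `b` meets the base of `b`.
  · rw [hμ _ (measurableSet_base hτ n b), Finset.sum_eq_single b,
      Finset.sum_eq_single_of_mem 0 (Finset.mem_range.mpr (hτ.height_pos n b))]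
    · rw [← hcon, ← hcon {y | y 0 = b}]
      congr 1
      ext y
      refine ⟨fun h => ⟨h.1.1, h.2⟩, fun h => ⟨⟨h.1, hbase h.1 h.2⟩, h.2⟩⟩
    · intro k hk hk0
      rw [← hcon]
      convert measure_empty (μ := ν)
      refine Set.eq_empty_of_forall_notMem fun y hy => hk0 ?_
      exact (hrec.eq_of_shift_mem_base hτ (Finset.mem_range.mp hk) (hbase hy.1.1 hy.2) hy.1.2).2
    · intro a _ hab
      refine Finset.sum_eq_zero fun k hk => ?_
      rw [← hcon]
      convert measure_empty (μ := ν)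
      refine Set.eq_empty_of_forall_notMem fun y hy => hab ?_
      exact (hrec.eq_of_shift_mem_base hτ (Finset.mem_range.mp hk) (hbase hy.1.1 hy.2) hy.1.2).1
    · simp

/-- If the subshift carries only one invariant measure, then so does the shift of level `n`, as far
as the measures of letters are concerned. -/
theorem Recognizable.measure_letter_eq (hrec : τ.Recognizable) (hτ : τ.Nonerasing)
    (huniq : ∀ μ ν : Measure (ℤ → A 0),
      IsProbabilityMeasure μ ∧ MeasurePreserving shift μ μ ∧ μ (τ.subshift)ᶜ = 0 →
      IsProbabilityMeasure ν ∧ MeasurePreserving shift ν ν ∧ ν (τ.subshift)ᶜ = 0 → μ = ν)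
    (n : ℕ) [TopologicalSpace (A n)] [DiscreteTopology (A n)] [MeasurableSpace (A n)]
    [BorelSpace (A n)] {ν ν' : Measure (ℤ → A n)} [IsProbabilityMeasure ν]
    [IsProbabilityMeasure ν'] (hν : MeasurePreserving shift ν ν)
    (hν' : MeasurePreserving shift ν' ν') (hX : ν (τ.levelShift n)ᶜ = 0)
    (hX' : ν' (τ.levelShift n)ᶜ = 0) (a : A n) : ν.real {y | y 0 = a} = ν'.real {y | y 0 = a} := by
  have hsum : ∀ (ρ : Measure (ℤ → A n)) [IsProbabilityMeasure ρ],
      ∑ a, ρ.real {y | y 0 = a} = 1 := by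
    intro ρ _
    have hm : Measurable fun y : ℤ → A n => y 0 := measurable_pi_apply 0
    have := sum_measureReal_preimage_singleton (μ := ρ) (f := fun y : ℤ → A n => y 0)
      (Finset.univ : Finset (A n)) (fun a _ => hm (measurableSet_singleton a))
    rwa [Finset.coe_univ, Set.preimage_univ, probReal_univ] at this
  have hlift : ∀ (ρ : Measure (ℤ → A n)) [IsProbabilityMeasure ρ], MeasurePreserving shift ρ ρ →
      ρ (τ.levelShift n)ᶜ = 0 → ∃ (μ : Measure (ℤ → A 0)) (c : ℝ), (IsProbabilityMeasure μ ∧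
        MeasurePreserving shift μ μ ∧ μ (τ.subshift)ᶜ = 0) ∧
        ∀ a, ρ.real {y | y 0 = a} = c * μ.real (τ.base n a) := by
    intro ρ _ h1 h2
    obtain ⟨μ, hμ, h3, h4, h5⟩ := hrec.exists_lift hτ n h1 h2
    have h0 : μ ≠ 0 := by
      rintro rfl
      have := hsum ρ
      simp [Measure.real, ← h5] at this
    have : NeZero μ := ⟨h0⟩
    have hu : μ Set.univ ≠ 0 := Measure.measure_univ_ne_zero.mpr h0
    -- The factor `c` is the total mass of the lift, lost in normalizing.
    refine ⟨(μ Set.univ)⁻¹ • μ, (μ Set.univ).toReal, ⟨⟨?_⟩, ⟨measurable_shift, ?_⟩, ?_⟩, fun a => ?_⟩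
    · rw [Measure.smul_apply, smul_eq_mul, ENNReal.inv_mul_cancel hu (measure_ne_top _ _)]
    · rw [Measure.map_smul, h3.map_eq]
    · rw [Measure.smul_apply, h4, smul_zero]
    · rw [Measure.real, Measure.real, ← h5, Measure.smul_apply, smul_eq_mul, ENNReal.toReal_mul,
        ENNReal.toReal_inv, ← mul_assoc, mul_inv_cancel₀, one_mul]
      exact ENNReal.toReal_ne_zero.mpr ⟨hu, measure_ne_top _ _⟩
  obtain ⟨μ, c, hμ, h⟩ := hlift ν hν hX
  obtain ⟨μ', c', hμ', h'⟩ := hlift ν' hν' hX'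
  obtain rfl := huniq μ μ' hμ hμ'
  have h1 := hsum ν
  have h2 := hsum ν'
  -- Both letter vectors are multiples of the same vector of base measures and have sum one, so the
  -- factors coincide.
  simp only [h, h', ← Finset.mul_sum] at h1 h2 ⊢
  have hne : ∑ a, μ.real (τ.base n a) ≠ 0 := right_ne_zero_of_mul (h1.trans_ne one_ne_zero)
  rw [mul_right_cancel₀ hne (h1.trans h2.symm)]

/-- Unique ergodicity in terms of the invariant measures on the full shift that are carried by the
subshift. -/
theorem isUniquelyErgodic_iff : IsUniquelyErgodic τ.subshiftMap ↔
    ∃! μ : Measure (ℤ → A 0), IsProbabilityMeasure μ ∧ MeasurePreserving shift μ μ ∧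
      μ (τ.subshift)ᶜ = 0 := by
  have hXm : MeasurableSet (τ.subshift) := (τ.isClosed_levelShift 0).measurableSet
  have hemb : MeasurableEmbedding (Subtype.val : τ.subshift → ℤ → A 0) :=
    MeasurableEmbedding.subtype_coe hXm
  have hcomm : (Subtype.val : τ.subshift → ℤ → A 0) ∘ τ.subshiftMap = shift ∘ Subtype.val := rfl
  have hmS : Measurable τ.subshiftMap := (measurable_shift.comp measurable_subtype_coe).subtype_mk
  have hup : ∀ μ : Measure τ.subshift, IsProbabilityMeasure μ ∧ MeasurePreserving τ.subshiftMap μ μ →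
      IsProbabilityMeasure (μ.map Subtype.val) ∧
        MeasurePreserving shift (μ.map Subtype.val) (μ.map Subtype.val) ∧
        (μ.map Subtype.val) (τ.subshift)ᶜ = 0 := by
    rintro μ ⟨h1, h2⟩
    refine ⟨Measure.isProbabilityMeasure_map measurable_subtype_coe.aemeasurable,
      ⟨measurable_shift, ?_⟩, ?_⟩
    · rw [Measure.map_map measurable_shift measurable_subtype_coe, ← hcomm,
        ← Measure.map_map measurable_subtype_coe hmS, h2.map_eq]
    · rw [Measure.map_apply measurable_subtype_coe hXm.compl]
      convert measure_empty (μ := μ)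
      ext x
      simp
  have hdown : ∀ μ : Measure (ℤ → A 0), μ (τ.subshift)ᶜ = 0 →
      (μ.comap (Subtype.val : τ.subshift → ℤ → A 0)).map Subtype.val = μ := by
    intro μ h
    rw [hemb.map_comap, Subtype.range_coe]
    exact Measure.restrict_eq_self_of_ae_mem (mem_ae_iff.mpr h)
  have hinj : ∀ μ ν : Measure τ.subshift, μ.map Subtype.val = ν.map Subtype.val → μ = ν := by
    intro μ ν h
    rw [← hemb.comap_map μ, h, hemb.comap_map]
  have hdown' : ∀ μ : Measure (ℤ → A 0), IsProbabilityMeasure μ ∧ MeasurePreserving shift μ μ ∧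
      μ (τ.subshift)ᶜ = 0 →
      IsProbabilityMeasure (μ.comap (Subtype.val : τ.subshift → ℤ → A 0)) ∧
      MeasurePreserving τ.subshiftMap (μ.comap Subtype.val) (μ.comap Subtype.val) := by
    rintro μ ⟨h1, h2, h3⟩
    have hd := hdown μ h3
    constructor
    · refine ⟨?_⟩
      rw [hemb.comap_apply, Set.image_univ, Subtype.range_coe, ← Set.univ_inter (τ.subshift),
        measure_inter_conull h3, measure_univ]
    · refine ⟨hmS, hinj _ _ ?_⟩
      rw [Measure.map_map measurable_subtype_coe hmS, hcomm,
        ← Measure.map_map measurable_shift measurable_subtype_coe, hd, h2.map_eq]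
  constructor
  · rintro ⟨μ, hμ, huniq⟩
    refine ⟨_, hup μ hμ, fun ν hν => ?_⟩
    rw [← hdown ν hν.2.2, huniq _ (hdown' ν hν)]
  · rintro ⟨μ, hμ, huniq⟩
    refine ⟨_, hdown' μ hμ, fun ν hν => hinj _ _ ?_⟩
    rw [hdown μ hμ.2.2, huniq _ (hup ν hν)]

end Lift

end DirectiveSequence

/-! ### Length estimates, and a lower bound for the coefficient. -/

theorem List.length_le_length_flatMap {A B : Type*} (u : List A) {f : A → List B}
    (hf : ∀ a, f a ≠ []) : u.length ≤ (u.flatMap f).length := by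
  rw [List.length_flatMap]
  simpa using List.card_nsmul_le_sum (u.map fun a => (f a).length) 1
    (by simpa [Nat.one_le_iff_ne_zero] using fun a _ => hf a)

theorem List.length_flatMap_le {A B : Type*} (u : List A) {f : A → List B} {D : ℕ}
    (hf : ∀ a, (f a).length ≤ D) : (u.flatMap f).length ≤ u.length * D := by
  rw [List.length_flatMap]
  simpa using List.sum_le_card_nsmul (u.map fun a => (f a).length) D (by simpa using fun a _ => hf a)

theorem List.length_le_length_flatMap_of_mem {A B : Type*} {u : List A} (f : A → List B) {a : A}
    (ha : a ∈ u) : (f a).length ≤ (u.flatMap f).length := by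
  rw [List.length_flatMap]
  exact List.single_le_sum (by simp) _ (List.mem_map_of_mem ha)

theorem length_letterImage_le_morphismLength {A B : Type*} [Fintype A]
    (σ : FreeMonoid A →* FreeMonoid B) (a : A) : (letterImage σ a).length ≤ morphismLength σ :=
  Finset.le_sup (f := fun a => (letterImage σ a).length) (Finset.mem_univ a)

section LetterMean

variable {A B : Type*} {σ : FreeMonoid A →* FreeMonoid B}

theorem length_mul_letterMean (hσ : IsNonerasing σ) (g : B → ℝ) (a : A) :
    (letterImage σ a).length * letterMean σ g a = ((letterImage σ a).map g).sum := by
  have : ((letterImage σ a).length : ℝ) ≠ 0 := by exact_mod_cast (hσ.length_pos a).ne'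
  rw [letterMean, mul_div_cancel₀ _ this]

theorem letterMean_mono (σ : FreeMonoid A →* FreeMonoid B) {f g : B → ℝ} (hfg : ∀ b, f b ≤ g b)
    (a : A) : letterMean σ f a ≤ letterMean σ g a :=
  div_le_div_of_nonneg_right (List.sum_le_sum fun b _ => hfg b) (by positivity)

theorem letterMean_const (hσ : IsNonerasing σ) (c : ℝ) (a : A) :
    letterMean σ (fun _ => c) a = c := by
  have : ((letterImage σ a).length : ℝ) ≠ 0 := by exact_mod_cast (hσ.length_pos a).ne'
  simp [letterMean, this]

/-- The frequencies in one word sum to `1`, and each minimal frequency is smaller by at most `1 / (2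
|B|)`; summing over `B` loses at most `1/2`. -/
theorem half_le_dobrushin [Fintype A] [Nonempty A] [Fintype B] [DecidableEq B]
    (hσ : IsNonerasing σ) (hσ' : IsConstantLength σ)
    (h : ∀ (b : B) (a a' : A), |((letterImage σ a).count b : ℝ) / (letterImage σ a).length -
      ((letterImage σ a').count b : ℝ) / (letterImage σ a').length| ≤ 1 / (2 * Fintype.card B)) :
    1 / 2 ≤ dobrushin σ := by
  obtain ⟨a₀⟩ := ‹Nonempty A›
  have hL : (0 : ℝ) < (letterImage σ a₀).length := by exact_mod_cast hσ.length_pos a₀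
  have hB : (0 : ℝ) < Fintype.card B := by
    exact_mod_cast Fintype.card_pos_iff.mpr ⟨(letterImage σ a₀).head (hσ a₀)⟩
  have key : ∀ b, ((letterImage σ a₀).count b : ℝ) / (letterImage σ a₀).length -
      1 / (2 * Fintype.card B) ≤ minVector σ b / (letterImage σ a₀).length := by
    intro b
    obtain ⟨a, -, ha⟩ := Finset.exists_mem_eq_inf' (Finset.univ_nonempty (α := A))
      fun a => compositionMatrix σ b a
    have ha' : minVector σ b = (letterImage σ a).count b := ha
    have := (abs_le.mp (h b a₀ a)).2
    rw [hσ' a a₀] at this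
    rw [ha']
    linarith
  have := Finset.sum_le_sum fun b (_ : b ∈ Finset.univ) => key b
  rw [Finset.sum_sub_distrib, ← Finset.sum_div, ← Finset.sum_div _ fun b => (minVector σ b : ℝ),
    List.sum_count_eq_length,
    div_self hL.ne', Finset.sum_const, Finset.card_univ, nsmul_eq_mul] at this
  unfold dobrushin
  rw [hσ'.morphismLength_eq a₀]
  refine le_trans (le_of_eq ?_) this
  field_simp
  norm_num

end LetterMean

/-! ### Growth of lengths, frequencies, and the two implications. -/

namespace DirectiveSequence

variable {A : ℕ → Type*} {τ : DirectiveSequence A}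

theorem contraction_eq_block (τ : DirectiveSequence A) (n : ℕ → ℕ) (hn : StrictMono n) (k : ℕ) :
    τ.contraction n hn k = τ.block (hn.monotone (Nat.le_succ k)) := rfl

/-- Nonemptiness of the subshift enters the proof through this growth alone: a point contains words
of every length, each inside some `τ_{[0,N)}(a)`. -/
theorem exists_le_length_block_zero (hne : τ.subshift.Nonempty) (l : ℕ) :
    ∃ (N : ℕ) (a : A N), l ≤ (letterImage (τ.block (Nat.zero_le N)) a).length := by
  obtain ⟨x, hx⟩ := hne
  obtain ⟨N, h, a, ha⟩ := hx 0 l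
  refine ⟨N, a, ?_⟩
  simpa [window_eq_ofFn] using ha.length_le

section Dynamics

variable [∀ n, Fintype (A n)]

/-- The lengths of the words `τ_{[n,N)}(b)` tend to infinity with `N`. -/
theorem eventually_le_length_block (hτ : τ.Nonerasing) (hlen : τ.ConstantLength)
    (hne : τ.subshift.Nonempty) (n l : ℕ) :
    ∀ᶠ N in atTop, ∀ (h : n ≤ N) (b : A N), l ≤ (letterImage (τ.block h) b).length := by
  -- Constant length starts at level `1`; from level `0` one passes through level `1`, as nonerasing
  -- morphisms do not shorten words.
  wlog hn : 1 ≤ n generalizing n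
  · obtain rfl : n = 0 := by omega
    filter_upwards [this 1 le_rfl, eventually_ge_atTop 1] with N hN hN1 h b
    rw [letterImage_block_trans τ (Nat.zero_le 1) hN1]
    exact (hN hN1 b).trans (List.length_le_length_flatMap _ (hτ.block _))
  -- The sum exceeds every length attained at a level below `n`, forcing `n ≤ N`; the product forces
  -- `τ_{[n,N)}(a)` to have at least `l` letters.
  obtain ⟨N, a, ha⟩ := exists_le_length_block_zero hne
    ((∑ N ∈ Finset.range n, morphismLength (τ.block (Nat.zero_le N))) +
      l * morphismLength (τ.block (Nat.zero_le n)) + 1)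
  have hnN : n ≤ N := by
    by_contra! hlt
    have h1 := length_letterImage_le_morphismLength (τ.block (Nat.zero_le N)) a
    have h2 := Finset.single_le_sum (f := fun N => morphismLength (τ.block (Nat.zero_le N)))
      (fun _ _ => Nat.zero_le _) (Finset.mem_range.mpr hlt)
    omega
  have hl : l ≤ (letterImage (τ.block hnN) a).length := by
    by_contra! hlt
    rw [letterImage_block_trans τ (Nat.zero_le n) hnN] at ha
    have h1 := (letterImage (τ.block hnN) a).length_flatMap_le
      (length_letterImage_le_morphismLength (τ.block (Nat.zero_le n)))
    have h2 := Nat.mul_le_mul_right (morphismLength (τ.block (Nat.zero_le n))) hlt.le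
    omega
  filter_upwards [eventually_ge_atTop N] with M hM h b
  rw [letterImage_block_trans τ hnN hM]
  obtain ⟨c, hc⟩ := List.exists_mem_of_ne_nil _ (hτ.block hM b)
  exact (hl.trans (hlen.block hnN hn a c).le).trans (List.length_le_length_flatMap_of_mem _ hc)

variable [∀ n, Nonempty (A n)] [∀ n, DecidableEq (A n)]

theorem eventually_abs_letterMean_sub_le (hτ : τ.Nonerasing) (hlen : τ.ConstantLength)
    {n : ℕ → ℕ} (hn : StrictMono n)
    (hdiv : Tendsto (fun K : ℕ => ∑ k ∈ Finset.range K, dobrushin (τ.contraction n hn k))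
      atTop atTop) {k : ℕ} (hk : 1 ≤ k) (g : A (n k) → ℝ) {ε : ℝ} (hε : 0 < ε) :
    ∀ᶠ K in atTop, ∀ (h : n k ≤ n K) (b b' : A (n K)),
      |letterMean (τ.block h) g b - letterMean (τ.block h) g b'| ≤ ε := by
  have hnk : ∀ j, k ≤ j → 1 ≤ n j := fun j hj => (hk.trans hj).trans (hn.le_apply)
  obtain ⟨D, hD0, hD⟩ : ∃ D : ℝ, 0 ≤ D ∧ ∀ b b', |g b - g b'| ≤ D := by
    refine ⟨2 * ∑ b, |g b|, by positivity, fun b b' => ?_⟩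
    have h : ∀ b, |g b| ≤ ∑ b, |g b| := fun b =>
      Finset.single_le_sum (f := fun b => |g b|) (fun _ _ => abs_nonneg _) (Finset.mem_univ b)
    linarith [abs_sub (g b) (g b'), h b, h b']
  -- The product of the factors `1 - dobrushin` is bounded by the exponential of minus their sum.
  have hstep : ∀ K, k ≤ K → ∀ (h : n k ≤ n K) (b b' : A (n K)),
      |letterMean (τ.block h) g b - letterMean (τ.block h) g b'| ≤
        Real.exp (-∑ j ∈ Finset.Ico k K, dobrushin (τ.contraction n hn j)) * D := by
    intro K hK
    induction K, hK using Nat.le_induction with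
    | base =>
      intro h b b'
      simpa [block_self, letterMean, letterImage_id] using hD b b'
    | succ K hK ih =>
      intro h b b'
      have hc : IsConstantLength (τ.contraction n hn K) := hlen.block _ (hnk K hK)
      have h1 := letterMean_comp (τ.block (hn.monotone hK)) (τ.contraction n hn K)
        (hτ.block _) (hlen.block _ (hnk k le_rfl)) g
      rw [contraction_eq_block, ← block_trans] at h1
      rw [h1, Finset.sum_Ico_succ_top hK, neg_add, Real.exp_add, mul_right_comm, mul_comm]
      refine (abs_letterMean_sub_le _ (hτ.block _) hc _ (ih (hn.monotone hK)) b b').trans ?_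
      refine mul_le_mul_of_nonneg_right ?_ (by positivity)
      have := Real.add_one_le_exp (-dobrushin (τ.contraction n hn K))
      rw [← contraction_eq_block τ n hn K]
      linarith
  have hlim : Tendsto (fun K => Real.exp (-∑ j ∈ Finset.Ico k K,
      dobrushin (τ.contraction n hn j)) * D) atTop (nhds 0) := by
    rw [← zero_mul D]
    refine Tendsto.mul_const D (Real.tendsto_exp_neg_atTop_nhds_zero.comp ?_)
    refine (tendsto_atTop_add_const_right _
      (-∑ j ∈ Finset.range k, dobrushin (τ.contraction n hn j)) hdiv).congr' ?_
    filter_upwards [eventually_ge_atTop k] with K hK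
    rw [Finset.sum_Ico_eq_sub _ hK, sub_eq_add_neg]
  filter_upwards [hlim.eventually (eventually_le_nhds hε), eventually_ge_atTop k] with K hK hkK
    h b b'
  exact (hstep K hkK h b b').trans hK

/-- If the contraction coefficients have an infinite sum, then the frequencies of a word in the
words `τ_{[0,N)}(b)` are asymptotically independent of `b`. -/
theorem exists_uniform_frequency (hτ : τ.Nonerasing) (hlen : τ.ConstantLength)
    (hne : τ.subshift.Nonempty) {n : ℕ → ℕ} (hn : StrictMono n)
    (hdiv : Tendsto (fun K : ℕ => ∑ k ∈ Finset.range K, dobrushin (τ.contraction n hn k))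
      atTop atTop) (w : List (A 0)) {ε : ℝ} (hε : 0 < ε) :
    ∃ (N : ℕ) (α : ℝ), ∀ b : A N,
      |occurrences w (letterImage (τ.block (Nat.zero_le N)) b) - α * τ.height N b| ≤
        3 * ε * τ.height N b ∧ w.length ≤ ε * τ.height N b := by
  -- Level `n k` is high enough for straddling occurrences to be negligible, and `k ≥ 1` keeps to
  -- levels with constant length.
  obtain ⟨k, hk1, hk⟩ : ∃ k, 1 ≤ k ∧ ∀ a : A (n k), (w.length : ℝ) ≤ ε * τ.height (n k) a := by
    obtain ⟨l, hl⟩ := exists_nat_ge (w.length / ε)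
    obtain ⟨k, hk, hk1⟩ := ((hn.tendsto_atTop.eventually
      (eventually_le_length_block hτ hlen hne 0 l)).and (eventually_ge_atTop 1)).exists
    refine ⟨k, hk1, fun a => ?_⟩
    have : (l : ℝ) ≤ τ.height (n k) a := by exact_mod_cast hk (Nat.zero_le _) a
    rw [← div_le_iff₀' hε]
    exact hl.trans this
  let c : A (n k) → ℝ := fun a => occurrences w (letterImage (τ.block (Nat.zero_le (n k))) a)
  let g : A (n k) → ℝ := fun a => τ.height (n k) a
  -- The heights of level `n k` may differ because `τ 0` is arbitrary, so they are averaged like the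
  -- occurrences, and the frequency `α` is a quotient of two means.
  obtain ⟨K, ⟨hKc, hKg⟩, hkK⟩ := (((eventually_abs_letterMean_sub_le hτ hlen hn hdiv hk1 c hε).and
    (eventually_abs_letterMean_sub_le hτ hlen hn hdiv hk1 g hε)).and
      (eventually_ge_atTop k)).exists
  have h := hn.monotone hkK
  have hρ := hτ.block h
  obtain ⟨b₀⟩ := ‹∀ n, Nonempty (A n)› (n K)
  set C := letterMean (τ.block h) c
  set H := letterMean (τ.block h) g
  have hg1 : ∀ a, 1 ≤ g a := fun a =>
    Nat.one_le_cast.mpr (hτ.height_pos (n k) a)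
  have hH1 : ∀ b, 1 ≤ H b := fun b =>
    (letterMean_const hρ 1 b).symm.le.trans (letterMean_mono _ hg1 b)
  have hCH : ∀ b, C b ≤ H b := letterMean_mono _ fun a =>
    Nat.cast_le.mpr (occurrences_le_length w _)
  have hC0 : ∀ b, 0 ≤ C b := fun b =>
    (letterMean_const hρ 0 b).symm.le.trans (letterMean_mono _ (fun a => by positivity) b)
  have hwH : ∀ b, (w.length : ℝ) ≤ ε * H b := fun b => by
    have := (letterMean_const hρ (w.length / ε) b).symm.le.trans (letterMean_mono _ (g := g)
      (fun a => by rw [div_le_iff₀' hε]; exact hk a) b)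
    rwa [div_le_iff₀' hε] at this
  have hα0 : 0 ≤ C b₀ / H b₀ := div_nonneg (hC0 b₀) (zero_le_one.trans (hH1 b₀))
  have hα1 : C b₀ / H b₀ ≤ 1 := div_le_one_of_le₀ (hCH b₀) (zero_le_one.trans (hH1 b₀))
  have hα : C b₀ / H b₀ * H b₀ = C b₀ := div_mul_cancel₀ _ (zero_lt_one.trans_le (hH1 b₀)).ne'
  refine ⟨n K, C b₀ / H b₀, fun b => ?_⟩
  have hL1 : (1 : ℝ) ≤ (letterImage (τ.block h) b).length := by exact_mod_cast hρ.length_pos b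
  have e := letterImage_block_trans τ (Nat.zero_le (n k)) h b
  have hheight : (τ.height (n K) b : ℝ) = (letterImage (τ.block h) b).length * H b := by
    rw [length_mul_letterMean hρ, height, e, List.length_flatMap_cast]
    rfl
  have hlow := sum_occurrences_le_flatMap w (letterImage (τ.block h) b)
    (letterImage (τ.block (Nat.zero_le (n k))))
  have hup := occurrences_flatMap_le w (letterImage (τ.block h) b)
    (letterImage (τ.block (Nat.zero_le (n k))))
  rw [← e, ← length_mul_letterMean hρ] at hlow hup
  change _ * C b ≤ _ at hlow
  change _ ≤ _ * C b + _ at hup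
  rw [hheight]
  set L : ℝ := ((letterImage (τ.block h) b).length : ℝ)
  -- Since `C b₀ = α H b₀` and `0 ≤ α ≤ 1`, each oscillation contributes at most `ε`. The third `ε`
  -- of the statement pays for the at most `w.length` straddling occurrences per letter of level `n
  -- k`.
  have hdiff : |C b - C b₀ / H b₀ * H b| ≤ 2 * ε := by
    have e1 : C b - C b₀ / H b₀ * H b = (C b - C b₀) - C b₀ / H b₀ * (H b - H b₀) := by
      rw [mul_sub, hα]; ring
    rw [e1]
    refine (abs_sub _ _).trans ?_
    rw [abs_mul, abs_of_nonneg hα0]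
    have := mul_le_mul hα1 (hKg h b b₀) (abs_nonneg _) zero_le_one
    linarith [hKc h b b₀]
  have h2 : L * |C b - C b₀ / H b₀ * H b| ≤ L * (2 * (ε * H b)) := by
    refine mul_le_mul_of_nonneg_left (hdiff.trans ?_) (by linarith)
    have := mul_le_mul_of_nonneg_left (hH1 b) hε.le
    linarith
  have h3 : L * w.length ≤ L * (ε * H b) := mul_le_mul_of_nonneg_left (hwH b) (by linarith)
  have h4 : (w.length : ℝ) ≤ L * w.length := le_mul_of_one_le_left (by positivity) hL1
  refine ⟨?_, by linarith⟩
  have h5 : |L * C b - C b₀ / H b₀ * (L * H b)| = L * |C b - C b₀ / H b₀ * H b| := by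
    rw [← abs_of_nonneg (show 0 ≤ L by linarith), ← abs_mul, abs_of_nonneg (show 0 ≤ L by linarith)]
    congr 1
    ring
  rw [← h5] at h2
  have := abs_le.mp h2
  rw [abs_le]
  constructor <;> linarith

/-- The measure is a limit of orbit measures along the words `τ_{[n,N)}(b)`. A word outside the
language never occurs in them, so its cylinder is null. The index `m + 1` meets the strict
inequality `n < N` in the language. -/
theorem exists_level_measure (hτ : τ.Nonerasing) (hlen : τ.ConstantLength)
    (hne : τ.subshift.Nonempty) (n : ℕ) [TopologicalSpace (A n)] [DiscreteTopology (A n)]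
    [MeasurableSpace (A n)] [BorelSpace (A n)] (U : Ultrafilter ℕ) (hU : (U : Filter ℕ) ≤ atTop)
    (b : ∀ m, A (n + (m + 1))) :
    ∃ ν : Measure (ℤ → A n), IsProbabilityMeasure ν ∧ MeasurePreserving shift ν ν ∧
      ν (τ.levelShift n)ᶜ = 0 ∧ ∀ a, Tendsto (fun m =>
        ((letterImage (τ.block (Nat.le_add_right n (m + 1))) (b m)).count a : ℝ) /
          (letterImage (τ.block (Nat.le_add_right n (m + 1))) (b m)).length) U
        (nhds (ν.real {y | y 0 = a})) := by
  let u : ℕ → List (A n) := fun m => letterImage (τ.block (Nat.le_add_right n (m + 1))) (b m)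
  have hu : Tendsto (fun m => (u m).length) U atTop := by
    refine Tendsto.mono_left (tendsto_atTop.mpr fun l => ?_) hU
    have : Tendsto (fun m => n + (m + 1)) atTop atTop :=
      tendsto_atTop_mono (fun m => (by omega : m ≤ n + (m + 1))) tendsto_id
    filter_upwards [this.eventually (eventually_le_length_block hτ hlen hne n l)] with m hm
    exact hm _ _
  obtain ⟨ν, hν, hinv, hlim⟩ := exists_invariant_limit u U hu
  refine ⟨ν, hν, hinv, ?_, fun a => ?_⟩
  · have h0 : ∀ l, ν {x | window x 0 l ∉ τ.language n} = 0 := by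
      intro l
      have hsub : {x | window x 0 l ∉ τ.language n} ⊆
          ⋃ f : {f : Fin l → A n // FreeMonoid.ofList (List.ofFn f) ∉ τ.language n},
            wordCylinder (List.ofFn f.1) := by
        intro x hx
        refine Set.mem_iUnion.mpr ⟨⟨fun j => x (0 + j), ?_⟩, fun i hi => ?_⟩
        · rw [← window_eq_ofFn]; exact hx
        · simp
      refine measure_mono_null hsub (measure_iUnion_null fun f => ?_)
      have hz : ∀ m, occurrences (List.ofFn f.1) (u m) = 0 := fun m =>
        occurrences_eq_zero_of_not_infix fun h => f.2 ⟨n + (m + 1), by omega, b m, h⟩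
      have := hlim (List.ofFn f.1)
      simp only [hz, Nat.cast_zero, zero_div] at this
      exact (measureReal_eq_zero_iff).mp (tendsto_nhds_unique this tendsto_const_nhds)
    -- Invariance carries the statement from position `0` to every position.
    have hm : ∀ (m : ℤ) (l : ℕ), ν {x | window x m l ∉ τ.language n} = 0 := by
      intro m l
      have hmeas : ∀ m, MeasurableSet {x : ℤ → A n | window x m l ∉ τ.language n} := fun m =>
        (isClopen_window_mem m l (τ.language n)ᶜ).isOpen.measurableSet
      have hs : ∀ m, ν {x | window x (m + 1) l ∉ τ.language n} =
          ν {x | window x m l ∉ τ.language n} := fun m => by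
        rw [← hinv.measure_preimage (hmeas m).nullMeasurableSet]
        congr 1
        ext x
        simp only [Set.preimage_ofPred_eq, Set.mem_ofPred_eq, window_eq_ofFn, shift, add_right_comm]
      induction m using Int.induction_on with
      | zero => exact h0 l
      | succ i ih => rw [hs, ih]
      | pred i ih => rw [← hs, sub_add_cancel, ih]
    refine measure_mono_null (t := ⋃ (m : ℤ) (l : ℕ), {x | window x m l ∉ τ.language n}) ?_
      (measure_iUnion_null fun m => measure_iUnion_null fun l => hm m l)
    intro x hx
    simpa [levelShift] using hx
  · have := hlim [a]
    simp only [occurrences_singleton] at this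
    convert this using 4
    ext y
    simp [wordCylinder]

theorem exists_contraction_tendsto
    (h : ∀ n, 1 ≤ n → ∃ (N : ℕ) (h : n < N), 1 / 2 ≤ dobrushin (τ.block h.le)) :
    ∃ (n : ℕ → ℕ) (hn : StrictMono n), n 0 = 0 ∧
      Tendsto (fun K : ℕ => ∑ k ∈ Finset.range K, dobrushin (τ.contraction n hn k))
        atTop atTop := by
  -- From level `0` the step is arbitrary. Its term is only known to be nonnegative, whence the
  -- lower bound `(K - 1) / 2` for the partial sums.
  have h' : ∀ n, ∃ (N : ℕ) (h : n < N), 1 ≤ n → 1 / 2 ≤ dobrushin (τ.block h.le) := by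
    intro n
    by_cases hn : 1 ≤ n
    · obtain ⟨N, hN, hd⟩ := h n hn
      exact ⟨N, hN, fun _ => hd⟩
    · exact ⟨n + 1, by omega, fun h => absurd h hn⟩
  choose f hf hd using h'
  let n : ℕ → ℕ := fun k => Nat.rec 0 (fun _ m => f m) k
  have hn : StrictMono n := strictMono_nat_of_lt_succ fun k => hf (n k)
  refine ⟨n, hn, rfl, tendsto_atTop_mono (f := fun K : ℕ => ((K : ℝ) - 1) / 2) (fun K => ?_) ?_⟩
  · induction K with
    | zero => norm_num
    | succ K ih =>
      rw [Finset.sum_range_succ]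
      rcases Nat.eq_zero_or_pos K with rfl | hK
      · simpa using dobrushin_nonneg _
      · have : 1 / 2 ≤ dobrushin (τ.contraction n hn K) := hd (n K) (Nat.le_trans hK hn.le_apply)
        push_cast
        linarith
  · exact (tendsto_atTop_add_const_right _ (-1 : ℝ) tendsto_natCast_atTop_atTop).atTop_div_const
      two_pos

variable [TopologicalSpace (A 0)] [DiscreteTopology (A 0)] [MeasurableSpace (A 0)]
  [BorelSpace (A 0)]

theorem Recognizable.existsUnique_of_tendsto (hrec : τ.Recognizable) (hτ : τ.Nonerasing)
    (hlen : τ.ConstantLength) (hne : τ.subshift.Nonempty) {n : ℕ → ℕ} (hn : StrictMono n)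
    (hdiv : Tendsto (fun K : ℕ => ∑ k ∈ Finset.range K, dobrushin (τ.contraction n hn k))
      atTop atTop) :
    ∃! μ : Measure (ℤ → A 0), IsProbabilityMeasure μ ∧ MeasurePreserving shift μ μ ∧
      μ (τ.subshift)ᶜ = 0 := by
  refine existsUnique_of_exists_of_unique ?_ ?_
  · obtain ⟨μ, h1, h2, h3, -⟩ := exists_level_measure hτ hlen hne 0 (Ultrafilter.of atTop)
      (Ultrafilter.of_le atTop) (fun m => Classical.arbitrary _)
    exact ⟨μ, h1, h2, h3⟩
  · rintro μ ν ⟨_, h2, h3⟩ ⟨_, h2', h3'⟩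
    refine Measure.ext_of_wordCylinder h2 h2' fun w => ?_
    rw [← measureReal_eq_measureReal_iff]
    refine eq_of_forall_dist_le fun ε hε => ?_
    -- With `ε / 8`, each measure is within `4 * (ε / 8) = ε / 2` of the same `α`.
    obtain ⟨N, α, hα⟩ := exists_uniform_frequency hτ hlen hne hn hdiv w
      (show 0 < ε / 8 by positivity)
    have h4 := hrec.abs_measureReal_sub_le hτ h2 h3 w hα
    have h5 := hrec.abs_measureReal_sub_le hτ h2' h3' w hα
    rw [abs_sub_comm] at h5
    rw [Real.dist_eq]
    linarith [abs_sub_le (μ.real (wordCylinder w)) α (ν.real (wordCylinder w))]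

/-- Otherwise letters `b m`, `b' m` with separated frequencies exist at every level above `n`, and
their limit measures contradict `measure_letter_eq`. -/
theorem Recognizable.exists_half_le_dobrushin (hrec : τ.Recognizable) (hτ : τ.Nonerasing)
    (hlen : τ.ConstantLength) (hne : τ.subshift.Nonempty)
    (huniq : ∀ μ ν : Measure (ℤ → A 0),
      IsProbabilityMeasure μ ∧ MeasurePreserving shift μ μ ∧ μ (τ.subshift)ᶜ = 0 →
      IsProbabilityMeasure ν ∧ MeasurePreserving shift ν ν ∧ ν (τ.subshift)ᶜ = 0 → μ = ν)
    {n : ℕ} (hn : 1 ≤ n) : ∃ (N : ℕ) (h : n < N), 1 / 2 ≤ dobrushin (τ.block h.le) := by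
  by_contra! hcon
  have hex : ∀ m : ℕ, ∃ b b' : A (n + (m + 1)), ¬ ∀ a,
      |((letterImage (τ.block (Nat.le_add_right n (m + 1))) b).count a : ℝ) /
          (letterImage (τ.block (Nat.le_add_right n (m + 1))) b).length -
        ((letterImage (τ.block (Nat.le_add_right n (m + 1))) b').count a : ℝ) /
          (letterImage (τ.block (Nat.le_add_right n (m + 1))) b').length| ≤
        1 / (2 * Fintype.card (A n)) := by
    intro m
    by_contra! h
    exact (hcon (n + (m + 1)) (by omega)).not_ge
      (half_le_dobrushin (hτ.block _) (hlen.block _ hn) fun a b b' => h b b' a)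
  choose b b' hb using hex
  let _ : TopologicalSpace (A n) := ⊥
  have : DiscreteTopology (A n) := ⟨rfl⟩
  let _ : MeasurableSpace (A n) := borel (A n)
  have : BorelSpace (A n) := ⟨rfl⟩
  have hU := Ultrafilter.of_le (atTop : Filter ℕ)
  obtain ⟨ν, _, hν, hX, hlim⟩ := exists_level_measure hτ hlen hne n (Ultrafilter.of atTop) hU b
  obtain ⟨ν', _, hν', hX', hlim'⟩ :=
    exists_level_measure hτ hlen hne n (Ultrafilter.of atTop) hU b'
  have hε : (0 : ℝ) < 1 / (2 * Fintype.card (A n)) := by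
    have : 0 < Fintype.card (A n) := Fintype.card_pos
    positivity
  -- The separating letter may vary with `m`; finiteness of the alphabet makes all frequency
  -- differences small at once.
  have hev := eventually_all.mpr fun a => by
    have := ((hlim a).sub (hlim' a)).abs
    rw [hrec.measure_letter_eq hτ huniq n hν hν' hX hX', sub_self, abs_zero] at this
    exact this.eventually (eventually_le_nhds hε)
  obtain ⟨m, hm⟩ := hev.exists
  exact hb m hm

end Dynamics

end DirectiveSequence

theorem mainTheorem3 {A : ℕ → Type*} [∀ n, Fintype (A n)] [∀ n, Nonempty (A n)]
    [∀ n, DecidableEq (A n)] [TopologicalSpace (A 0)] [DiscreteTopology (A 0)]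
    [MeasurableSpace (A 0)] [BorelSpace (A 0)]
    (τ : DirectiveSequence A) (hτ : τ.Nonerasing) (hlen : τ.ConstantLength)
    (hrec : τ.Recognizable) (hne : τ.subshift.Nonempty) :
    (∃ (n : ℕ → ℕ) (hn : StrictMono n), n 0 = 0 ∧
      Tendsto (fun K : ℕ => ∑ k ∈ Finset.range K,
          (∑ a, (minVector (τ.contraction n hn k) a : ℝ)) /
            (morphismLength (τ.contraction n hn k) : ℝ)) atTop atTop) ↔
    IsUniquelyErgodic τ.subshiftMap := by
  rw [DirectiveSequence.isUniquelyErgodic_iff]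
  constructor
  · rintro ⟨n, hn, -, hdiv⟩
    exact hrec.existsUnique_of_tendsto hτ hlen hne hn hdiv
  · intro h
    exact DirectiveSequence.exists_contraction_tendsto fun n hn =>
      hrec.exists_half_le_dobrushin hτ hlen hne (fun _ _ => h.unique) hn
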